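/- \textbf{Setting.} A battery has power rating $B\ge 0$, rated energy capacity $E>0$, energy limits $\underline E\le\overline E$, dispatch interval duration $M>0$, single-trip efficiency $\eta\in(0,1]$ and cell replacement cost $R>0$. Starting from $e_0$, a dispatch $b_1,\dots,b_T$ gives the energy levels $e_t=e_{t-1}+M\eta[b_t]^+-M[-b_t]^+/\eta$. Its aging cost is $A(b)=ER\big(\sum_i\Phi(u_i)+\tfrac12\sum_j\Phi(h_j)\big)$, where $u_i$ are the depths of the full cycles and $h_j$ the depths of the half cycles (the ranges of the residue) that the four-point rainflow method finds in the profile $(e_0/E,\dots,e_T/E)$. The stress function $\Phi:[0,\infty)\to\mathbb R$ is differentiable with $\Phi(0)=0$ and derivative $\varphi=\Phi'$ (one-sided at $0$). With $\delta\in[0,1]$, $\mu_\lambda\ge0$ and $\mu_r>0$ given, let $\pi=\delta\mu_\lambda/(\mu_rM)$ and, for a capacity $C$ and a signal $r$, $$J(b)=\delta\frac{\mu_\lambda}{\mu_r}\sum_{t=1}^T|Cr_t-b_t|+A(b).$$ A response $b$ is admissible if for all $t$: $-B\le b_t\le B$, $\underline E\le e_t\le\overline E$ (also for $t=0$), $[b_t]^+\le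 C[r_t]^+$ and $[-b_t]^+\le C[-r_t]^+$ (the battery never exceeds its instruction). \textbf{Policy.} Let $\hat u\ge0$ satisfy $\varphi(\hat u)=\frac{\eta^2+1}{\eta R}\pi$. Before interval $t$, let $e$ be the current energy level, and $e^{\max}$, $e^{\min}$ the largest and smallest levels so far (including $e$ and $e_0$). The threshold policy $g$ sets $\overline E^g=\min\{\overline E,e^{\min}+\hat uE\}$, $\underline E^g=\max\{\underline E,e^{\max}-\hat uE\}$ and $$b^g_t=\min\{\tfrac1{M\eta}(\overline E^g-e),\,Cr_t\}\ \text{ if } Cr_t\ge0,\qquad b^g_t=\max\{\tfrac{\eta}{M}(\underline E^g-e),\,Cr_t\}\ \text{ if } Cr_t<0 .$$ \textbf{Theorem 1.} Suppose $\Phi$ is strictly convex. Then: (a) for every $T$, $e_0\in[\underline E,\overline E]$, $C\in[0,B]$ and $r_1,\dots,r_T\in[-1,1]$, the response $b^g$ is admissible, and all its rainflow full and half cycles have depth at most $\hat u$; (b) there is a constant $\epsilon$, independent of $T$, $e_0$, $C$ and $r$, such that for all $T$, $e_0\in[\underline E,\overline E]$, $C\in[0,B]$, $r\in[-1,1]^T$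 and all admissible $b$ (in particular an offline optimal $b^*$, chosen with full knowledge of $r$), $$J(b^g)-J(b)\le\epsilon;$$ (c) put $J_v(v)=\frac1\eta\pi Ev-\frac12ER\,\Phi(v)$ and $J_w(w)=\eta\pi Ew-\frac12ER\,\Phi(w)$. If $\hat v,\hat w\ge0$ satisfy $\varphi(\hat v)=\frac{2\pi}{\eta R}$ and $\varphi(\hat w)=\frac{2\pi\eta}{R}$ (so that they maximize $J_v$ and $J_w$), then (b) holds with $$\epsilon=2J_w(\hat w)+J_v(\hat v)-2J_w(\hat u)-J_v(\hat u).$$ -/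

import Mathlib

/-- The physical and economic parameters of a battery: power rating `B`, rated energy capacity `E`,
energy limits `Elo ≤ Ehi`, dispatch interval duration `M`, single-trip efficiency `η`,
and cell replacement cost `R` per unit of energy capacity. -/
structure Battery where
  B : ℝ
  E : ℝ
  Elo : ℝ
  Ehi : ℝ
  M : ℝ
  η : ℝ
  R : ℝ
  B_nonneg : 0 ≤ B
  E_pos : 0 < E
  Elo_le_Ehi : Elo ≤ Ehi
  M_pos : 0 < M
  η_pos : 0 < η
  η_le_one : η ≤ 1
  R_pos : 0 < R

/-! ### Rainflow cycle counting -/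

section Rainflow

open Classical in
/-- The turning points of a profile: the first and the last point together with the strict changes
of direction. A point that lies between the last kept point and its successor is dropped. -/
noncomputable def turningPoints : List ℝ → List ℝ
  | [] => []
  | [a] => [a]
  | [a, b] => if a = b then [a] else [a, b]
  | a :: b :: c :: l =>
      if (a ≤ b ∧ b ≤ c) ∨ (c ≤ b ∧ b ≤ a) then turningPoints (a :: c :: l)
      else a :: turningPoints (b :: c :: l)
termination_by l => l.length

open Classical in
/-- Put the turning point `d` on top of a stack of earlier turning points (latest first), closing
full cycles: as long as the middle range `|c - b|` of the last four points `a, b, c, d` exceeds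
neither of its two neighbours, it is recorded as a full cycle and `b`, `c` are deleted.
Returns the depths of the closed cycles and the new stack. -/
noncomputable def closeCycles (d : ℝ) : List ℝ → List ℝ × List ℝ
  | [] => ([], [d])
  | [c] => ([], [d, c])
  | [c, b] => ([], [d, c, b])
  | c :: b :: a :: s =>
      if |c - b| ≤ |b - a| ∧ |c - b| ≤ |d - c| then
        (|c - b| :: (closeCycles d (a :: s)).1, (closeCycles d (a :: s)).2)
      else ([], d :: c :: b :: a :: s)
termination_by s => s.length

/-- Scan a list of turning points, starting from a stack of earlier ones. Returns the depths of all
full cycles and the remaining residue (latest point first). -/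
noncomputable def rainflowScan : List ℝ → List ℝ → List ℝ × List ℝ
  | stack, [] => ([], stack)
  | stack, x :: l =>
      ((closeCycles x stack).1 ++ (rainflowScan (closeCycles x stack).2 l).1,
        (rainflowScan (closeCycles x stack).2 l).2)

/-- The depths of the full cycles that the rainflow method identifies in a profile. -/
noncomputable def fullCycles (x : List ℝ) : List ℝ :=
  (rainflowScan [] (turningPoints x)).1

/-- The residue of a profile (latest point first): no further full cycle can be identified in it. -/
noncomputable def residue (x : List ℝ) : List ℝ :=
  (rainflowScan [] (turningPoints x)).2

/-- The depths of the half cycles: the ranges between consecutive points of the residue. -/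
noncomputable def halfCycles (x : List ℝ) : List ℝ :=
  List.zipWith (fun p q => |p - q|) (residue x) (residue x).tail

/-- The total life loss of a profile; a half cycle causes half the stress of a full cycle. -/
noncomputable def lifeLoss (Φ : ℝ → ℝ) (x : List ℝ) : ℝ :=
  ((fullCycles x).map Φ).sum + ((halfCycles x).map Φ).sum / 2

end Rainflow

namespace Battery

/-- The energy level after one interval at dispatch power `b`, starting from the level `e`. -/
noncomputable def nextEnergy (S : Battery) (e b : ℝ) : ℝ :=
  e + S.M * S.η * max b 0 - S.M * max (-b) 0 / S.η

/-- The energy level after `t` intervals; `b t` is the dispatch in the interval that starts at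
time `t`, so that the `T` intervals are indexed by `0, …, T - 1`. -/
noncomputable def energy (S : Battery) (e₀ : ℝ) (b : ℕ → ℝ) : ℕ → ℝ
  | 0 => e₀
  | t + 1 => S.nextEnergy (energy S e₀ b t) (b t)

/-- The normalized state of charge profile at the times `0, …, T`. -/
noncomputable def socProfile (S : Battery) (e₀ : ℝ) (b : ℕ → ℝ) (T : ℕ) : List ℝ :=
  (List.range (T + 1)).map fun t => S.energy e₀ b t / S.E

/-- The cycle aging cost of a dispatch over `T` intervals. -/
noncomputable def agingCost (S : Battery) (Φ : ℝ → ℝ) (e₀ : ℝ) (T : ℕ) (b : ℕ → ℝ) : ℝ :=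
  S.E * S.R * lifeLoss Φ (S.socProfile e₀ b T)

/-- Mismatch penalty (at the rate `κ`) plus aging cost of the dispatch `b` under the
instructions `C * r t`. -/
noncomputable def cost (S : Battery) (Φ : ℝ → ℝ) (κ e₀ C : ℝ) (r : ℕ → ℝ) (T : ℕ)
    (b : ℕ → ℝ) : ℝ :=
  κ * (∑ t ∈ Finset.range T, |C * r t - b t|) + S.agingCost Φ e₀ T b

/-- The admissible responses: the power rating, the energy limits, and the requirement that the
response never exceeds the instruction, in either direction. -/
structure Admissible (S : Battery) (e₀ C : ℝ) (r : ℕ → ℝ) (T : ℕ) (b : ℕ → ℝ) : Prop where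
  power : ∀ t < T, -S.B ≤ b t ∧ b t ≤ S.B
  energy_mem : ∀ t ≤ T, S.Elo ≤ S.energy e₀ b t ∧ S.energy e₀ b t ≤ S.Ehi
  charge : ∀ t < T, max (b t) 0 ≤ C * max (r t) 0
  discharge : ∀ t < T, max (-b t) 0 ≤ C * max (-r t) 0

/-! ### The threshold control policy -/

/-- What the policy remembers: the current energy level and the extreme levels seen so far. -/
structure PolicyState where
  e : ℝ
  emax : ℝ
  emin : ℝ

/-- The dispatch that the policy with depth threshold `u` selects for the instruction `p`. -/
noncomputable def policyDispatch (S : Battery) (u : ℝ) (s : PolicyState) (p : ℝ) : ℝ :=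
  if 0 ≤ p then min (1 / (S.M * S.η) * (min S.Ehi (s.emin + u * S.E) - s.e)) p
  else max (S.η / S.M * (max S.Elo (s.emax - u * S.E) - s.e)) p

/-- The state of the policy after one interval with instruction `p`. -/
noncomputable def policyStep (S : Battery) (u : ℝ) (s : PolicyState) (p : ℝ) : PolicyState where
  e := S.nextEnergy s.e (S.policyDispatch u s p)
  emax := max s.emax (S.nextEnergy s.e (S.policyDispatch u s p))
  emin := min s.emin (S.nextEnergy s.e (S.policyDispatch u s p))

/-- The state of the policy at time `t`; it depends on `r 0, …, r (t - 1)` only. -/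
noncomputable def policyState (S : Battery) (u e₀ C : ℝ) (r : ℕ → ℝ) : ℕ → PolicyState
  | 0 => ⟨e₀, e₀, e₀⟩
  | t + 1 => S.policyStep u (policyState S u e₀ C r t) (C * r t)

/-- The response of the threshold policy to the signal `r`. -/
noncomputable def policy (S : Battery) (u e₀ C : ℝ) (r : ℕ → ℝ) (t : ℕ) : ℝ :=
  S.policyDispatch u (S.policyState u e₀ C r t) (C * r t)

/-! ### Prices and half-cycle profits -/

/-- The mismatch penalty price per unit of energy. -/
noncomputable def penaltyPrice (S : Battery) (δ μlam μr : ℝ) : ℝ := δ * (μlam / (μr * S.M))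

/-- The penalty avoided minus the aging caused by a charging half cycle of depth `v`. -/
noncomputable def chargeProfit (S : Battery) (Φ : ℝ → ℝ) (p v : ℝ) : ℝ :=
  1 / S.η * p * S.E * v - 1 / 2 * S.E * S.R * Φ v

/-- The penalty avoided minus the aging caused by a discharging half cycle of depth `w`. -/
noncomputable def dischargeProfit (S : Battery) (Φ : ℝ → ℝ) (p w : ℝ) : ℝ :=
  S.η * p * S.E * w - 1 / 2 * S.E * S.R * Φ w

end Battery

/-!
The regret bound rests on a description of rainflow counting by hysteresis operators. Divide all
energies by `E`. Since an admissible response has the sign of the instruction and never exceeds it,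
the mismatch penalty is a constant minus a reward for the energy moved. With full cycles counted as
two half cycles, the cost becomes, up to a constant and the factor `E * R / 2`,
`- (∑ f (depth) + k * (x_T - x_0))`, where `f v = c * v - Φ v` is concave and maximal at `uhat`,
`c = φ uhat`, and `k ≥ 0` measures the asymmetry between charging and discharging
(`Battery.cost_eq`).

A concave increasing function on `[0, uhat]` vanishing at `0` is, on a finite set, a nonnegative
combination of the functions `min · s` with `s ≤ uhat` (`exists_eq_sum_min`), so it suffices to
compare the sums of the cycle depths capped at `s`. Let a window of width `s` be dragged along by
the profile (the play operator) and let the stop operator be the position of the profile in the window.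
Deleting a rainflow cycle of depth `u` from the profile does not affect the window afterwards and
takes exactly `2 * min u s` from the variation of the stop operator (`stop_cycle`). In the residue
the ranges first increase and then decrease, so that for a suitable initial window the stop operator
follows each half cycle up to the depth `s` (`exists_stopVar_eq_of_irreducible`). Hence the capped
sum is the largest variation of the stop operator over all initial windows.

The policy moves at least as much as any other admissible response, in the same direction, until it
is blocked by an energy limit or by its own range reaching `uhat`. Comparing the two stop operators
by an invariant that bounds the leads in upward and in downward movement separately shows that the
policy has the larger capped sums for all `s ≤ uhat` (`Dominated.exists_goodWindow`,
`Dominated.rainflowSum_min_le`). This gives the regret bound up to the term `k * (x_T - y_T)`, which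
is bounded by the energy limits. For the closed form, the difference of the final levels is split
into the excess over `uhat` of the deepest half cycle of `x`, paid for by one charging half cycle,
and a rest `2 * (uhat - a)` that costs the competitor part of its capped sums for `s > a`, paid for
by two discharging half cycles (`Dominated.rainflowSum_add_le`).
-/

/-! ### The play operator and its complementary stop operator -/

/-- One step of the play operator of width `s`: the window `[p, p + s]` is moved as little as
possible so that it contains the new input `d`. The window is represented by its lower end. -/
noncomputable def playStep (s p d : ℝ) : ℝ := max (d - s) (min d p)

/-- The variation of the stop operator (the position of the input relative to the play window)
along the remaining input `l`, when the window is at `p` and the input at `c`. -/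
noncomputable def stopVar (s : ℝ) : ℝ → ℝ → List ℝ → ℝ
  | _, _, [] => 0
  | p, c, d :: l => |(d - playStep s p d) - (c - p)| + stopVar s (playStep s p d) d l

/-- The variation of the stop operator along a profile, started from the window at `p`. -/
noncomputable def totalStopVar (s p : ℝ) : List ℝ → ℝ
  | [] => 0
  | c :: l => stopVar s (playStep s p c) c l

theorem playStep_le {s : ℝ} (hs : 0 ≤ s) (p d : ℝ) : playStep s p d ≤ d :=
  max_le (by linarith) (min_le_left _ _)

theorem le_playStep_add (s p d : ℝ) : d ≤ playStep s p d + s := by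
  have := le_max_left (d - s) (min d p)
  unfold playStep; linarith

theorem playStep_eq_self {s p d : ℝ} (h1 : p ≤ d) (h2 : d ≤ p + s) : playStep s p d = p := by
  unfold playStep; rw [min_eq_right h1, max_eq_right (by linarith)]

theorem playStep_up {s p a d : ℝ} (h1 : p ≤ a) (h : a ≤ d) :
    playStep s p d = max (d - s) p ∧
      d - playStep s p d - (a - p) = min (d - a) (p + s - a) := by
  have h3 : playStep s p d = max (d - s) p := by
    unfold playStep; rw [min_eq_right (h1.trans h)]
  refine ⟨h3, ?_⟩
  rw [h3]
  rcases le_total (d - s) p with h4 | h4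
  · rw [max_eq_right h4, min_eq_left (by linarith)]; ring
  · rw [max_eq_left h4, min_eq_right (by linarith)]; ring

theorem playStep_down {s p a d : ℝ} (h1 : p ≤ a) (h2 : a ≤ p + s) (h : d ≤ a) :
    playStep s p d = min d p ∧
      d - playStep s p d - (a - p) = - min (a - d) (a - p) := by
  have h3 : playStep s p d = min d p := by
    unfold playStep
    rw [max_eq_right (le_min (by linarith) (by linarith))]
  refine ⟨h3, ?_⟩
  rw [h3]
  rcases le_total d p with h4 | h4
  · rw [min_eq_left h4, min_eq_right (by linarith)]; ring
  · rw [min_eq_right h4, min_eq_left (by linarith)]; ring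

theorem stop_step_up {s p a d : ℝ} (h1 : p ≤ a) (h2 : a ≤ p + s) (h : a ≤ d) :
    |d - playStep s p d - (a - p)| = min (d - a) (p + s - a) := by
  rw [(playStep_up h1 h).2, abs_of_nonneg (le_min (by linarith) (by linarith))]

theorem stop_step_down {s p a d : ℝ} (h1 : p ≤ a) (h2 : a ≤ p + s) (h : d ≤ a) :
    |d - playStep s p d - (a - p)| = min (a - d) (a - p) := by
  rw [(playStep_down h1 h2 h).2, abs_neg, abs_of_nonneg (le_min (by linarith) (by linarith))]

/-- `b` lies weakly between `a` and `c`. -/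
def Between (a b c : ℝ) : Prop := (a ≤ b ∧ b ≤ c) ∨ (c ≤ b ∧ b ≤ a)

/-- The points `a, b, c, d` go up, down, up or down, up, down, and the middle range is the smallest:
the pattern in which the rainflow method closes a cycle. -/
def Closable (a b c d : ℝ) : Prop :=
  ((a ≤ b ∧ c ≤ b ∧ c ≤ d) ∨ (b ≤ a ∧ b ≤ c ∧ d ≤ c)) ∧ |c - b| ≤ |b - a| ∧ |c - b| ≤ |d - c|

theorem stop_between {s p a b c : ℝ} (h1 : p ≤ a) (h2 : a ≤ p + s) (h : Between a b c) :
    playStep s (playStep s p b) c = playStep s p c ∧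
    |b - playStep s p b - (a - p)| + |c - playStep s (playStep s p b) c - (b - playStep s p b)|
      = |c - playStep s p c - (a - p)| := by
  have hs : 0 ≤ s := by linarith
  have hb1 := playStep_le hs p b
  have hb2 := le_playStep_add s p b
  rcases h with ⟨hab, hbc⟩ | ⟨hcb, hba⟩
  · rw [stop_step_up h1 h2 hab, stop_step_up hb1 hb2 hbc, stop_step_up h1 h2 (hab.trans hbc),
      (playStep_up hb1 hbc).1, (playStep_up h1 hab).1,
      (playStep_up h1 (hab.trans hbc)).1]
    constructor <;> simp only [max_def, min_def] <;> split_ifs <;> linarith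
  · rw [stop_step_down h1 h2 hba, stop_step_down hb1 hb2 hcb, stop_step_down h1 h2 (hcb.trans hba),
      (playStep_down hb1 hb2 hcb).1, (playStep_down h1 h2 hba).1,
      (playStep_down h1 h2 (hcb.trans hba)).1]
    constructor <;> simp only [min_def] <;> split_ifs <;> linarith

/-- Deleting a closed cycle does not change the play window after it, and removes twice the depth of
the cycle, capped at `s`, from the variation of the stop operator. -/
theorem stop_cycle {s p a b c d : ℝ} (h1 : p ≤ a) (h2 : a ≤ p + s) (h : Closable a b c d) :
    playStep s (playStep s (playStep s p b) c) d = playStep s p d ∧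
    |b - playStep s p b - (a - p)|
      + (|c - playStep s (playStep s p b) c - (b - playStep s p b)|
      + |d - playStep s (playStep s (playStep s p b) c) d
          - (c - playStep s (playStep s p b) c)|)
      = 2 * min |c - b| s + |d - playStep s p d - (a - p)| := by
  have hs : 0 ≤ s := by linarith
  have hb1 := playStep_le hs p b
  have hb2 := le_playStep_add s p b
  have hc1 := playStep_le hs (playStep s p b) c
  have hc2 := le_playStep_add s (playStep s p b) c
  obtain ⟨⟨hab, hcb, hcd⟩ | ⟨hab, hcb, hcd⟩, h3, h4⟩ := h
  · rw [abs_of_nonpos (by linarith : c - b ≤ 0)] at h3 h4 ⊢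
    rw [abs_of_nonneg (by linarith)] at h3 h4
    have hac : a ≤ c := by linarith
    have hbd : b ≤ d := by linarith
    rw [stop_step_up h1 h2 hab, stop_step_down hb1 hb2 hcb, stop_step_up hc1 hc2 hcd,
      stop_step_up h1 h2 (hac.trans hcd), (playStep_up hc1 hcd).1,
      (playStep_down hb1 hb2 hcb).1, (playStep_up h1 hab).1,
      (playStep_up h1 (hac.trans hcd)).1]
    constructor <;> simp only [max_def, min_def] <;> split_ifs <;> linarith
  · rw [abs_of_nonneg (by linarith : 0 ≤ c - b)] at h3 h4 ⊢
    rw [abs_of_nonpos (by linarith)] at h3 h4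
    have hac : c ≤ a := by linarith
    have hbd : d ≤ b := by linarith
    rw [stop_step_down h1 h2 hab, stop_step_up hb1 hb2 hcb, stop_step_down hc1 hc2 hcd,
      stop_step_down h1 h2 (hcd.trans hac), (playStep_down hc1 hc2 hcd).1,
      (playStep_up hb1 hcb).1, (playStep_down h1 h2 hab).1,
      (playStep_down h1 h2 (hcd.trans hac)).1]
    constructor <;> simp only [max_def, min_def] <;> split_ifs <;> linarith

/-! ### Quantities that behave well under rainflow deletions -/

/-- A quantity `F` of profiles that ignores points without a change of direction, and of which every
deleted full cycle of depth `u` carries the share `g u`. -/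
structure RainflowAdditive (F : List ℝ → ℝ) (g : ℝ → ℝ) : Prop where
  dup : ∀ pre a, F (pre ++ [a, a]) = F (pre ++ [a])
  between : ∀ pre a b c post, Between a b c →
    F (pre ++ a :: b :: c :: post) = F (pre ++ a :: c :: post)
  cycle : ∀ pre a b c d post, Closable a b c d →
    F (pre ++ a :: b :: c :: d :: post) = g |c - b| + F (pre ++ a :: d :: post)

theorem RainflowAdditive.turningPoints {F : List ℝ → ℝ} {g : ℝ → ℝ} (hF : RainflowAdditive F g)
    (l : List ℝ) : ∀ pre, F (pre ++ turningPoints l) = F (pre ++ l) := by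
  induction l using turningPoints.induct with
  | case1 => intro pre; simp [_root_.turningPoints]
  | case2 a => intro pre; simp [_root_.turningPoints]
  | case3 a => intro pre; simp [_root_.turningPoints, hF.dup]
  | case4 a b h => intro pre; simp [_root_.turningPoints, h]
  | case5 a b c l h ih =>
    intro pre
    rw [_root_.turningPoints, if_pos h, ih, hF.between _ _ _ _ _ h]
  | case6 a b c l h ih =>
    intro pre
    rw [_root_.turningPoints, if_neg h]
    simpa using ih (pre ++ [a])

/-- The profile alternates weakly between upward and downward moves, starting upwards if
`up = true`. -/
def Zigzag : Bool → List ℝ → Prop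
  | up, a :: b :: l => (if up then a ≤ b else b ≤ a) ∧ Zigzag (!up) (b :: l)
  | _, _ => True

theorem turningPoints_cons (a : ℝ) (l : List ℝ) : ∃ l', turningPoints (a :: l) = a :: l' := by
  generalize h : a :: l = m
  induction m using turningPoints.induct generalizing l with
  | case1 => simp at h
  | case2 b => simp_all [turningPoints]
  | case3 b => simp_all [turningPoints]
  | case4 b c hbc => simp_all [turningPoints]
  | case5 b c d m hb ih =>
    rw [turningPoints, if_pos hb]
    simp only [List.cons.injEq] at h
    exact ih (d :: m) (by rw [h.1])
  | case6 b c d m hb ih =>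
    rw [turningPoints, if_neg hb]
    simp only [List.cons.injEq] at h
    exact ⟨_, by rw [h.1]⟩

theorem zigzag_turningPoints_of_lt (l : List ℝ) : ∀ a b : ℝ,
    (a < b → Zigzag true (turningPoints (a :: b :: l))) ∧
    (b < a → Zigzag false (turningPoints (a :: b :: l))) := by
  induction l with
  | nil =>
    intro a b
    constructor <;> intro h <;> simp [turningPoints, h.ne, h.ne', Zigzag, h.le]
  | cons c l ih =>
    intro a b
    constructor <;> intro h
    · rw [turningPoints]
      split_ifs with h'
      · exact (ih a c).1 (by grind)
      · obtain ⟨l', hl'⟩ := turningPoints_cons b (c :: l)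
        have := (ih b c).2 (by grind)
        rw [hl'] at this ⊢
        exact ⟨by simpa using h.le, by simpa using this⟩
    · rw [turningPoints]
      split_ifs with h'
      · exact (ih a c).2 (by grind)
      · obtain ⟨l', hl'⟩ := turningPoints_cons b (c :: l)
        have := (ih b c).1 (by grind)
        rw [hl'] at this ⊢
        exact ⟨by simpa using h.le, by simpa using this⟩

theorem exists_zigzag_turningPoints (l : List ℝ) : ∃ up, Zigzag up (turningPoints l) := by
  match l with
  | [] => exact ⟨true, by simp [turningPoints, Zigzag]⟩
  | [a] => exact ⟨true, by simp [turningPoints, Zigzag]⟩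
  | a :: b :: l =>
    rcases lt_trichotomy a b with h | h | h
    · exact ⟨_, (zigzag_turningPoints_of_lt l a b).1 h⟩
    · subst h
      cases l with
      | nil => exact ⟨true, by simp [turningPoints, Zigzag]⟩
      | cons c l =>
        rw [turningPoints, if_pos (by rcases le_total a c with h | h <;> simp [h])]
        exact exists_zigzag_turningPoints (a :: c :: l)
    · exact ⟨_, (zigzag_turningPoints_of_lt l a b).2 h⟩
termination_by l.length

theorem Zigzag.closable {up : Bool} {pre post : List ℝ} {a b c d : ℝ}
    (h : Zigzag up (pre ++ a :: b :: c :: d :: post))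
    (h1 : |c - b| ≤ |b - a|) (h2 : |c - b| ≤ |d - c|) : Closable a b c d := by
  induction pre generalizing up with
  | nil =>
    obtain ⟨h3, h4, h5, -⟩ := h
    refine ⟨?_, h1, h2⟩
    cases up <;> simp_all
  | cons x pre ih =>
    cases pre with
    | nil => exact ih h.2
    | cons y pre => exact ih h.2

theorem Zigzag.delete {up : Bool} {pre post : List ℝ} {a b c d : ℝ}
    (h : Zigzag up (pre ++ a :: b :: c :: d :: post))
    (h1 : |c - b| ≤ |b - a|) : Zigzag up (pre ++ a :: d :: post) := by
  induction pre generalizing up with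
  | nil =>
    obtain ⟨h3, h4, h5, h6⟩ := h
    refine ⟨?_, by simpa using h6⟩
    cases up <;> simp at h3 h4 h5 ⊢ <;> grind
  | cons x pre ih =>
    cases pre with
    | nil => exact ⟨h.1, ih h.2⟩
    | cons y pre => exact ⟨h.1, ih h.2⟩

theorem RainflowAdditive.closeCycles {F : List ℝ → ℝ} {g : ℝ → ℝ} (hF : RainflowAdditive F g)
    {up : Bool} (x : ℝ) (stack : List ℝ) : ∀ post, Zigzag up (stack.reverse ++ x :: post) →
    Zigzag up ((closeCycles x stack).2.reverse ++ post) ∧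
    F (stack.reverse ++ x :: post) =
      ((closeCycles x stack).1.map g).sum + F ((closeCycles x stack).2.reverse ++ post) := by
  induction stack using closeCycles.induct (d := x) with
  | case1 => intro post h; simpa [_root_.closeCycles] using h
  | case2 c => intro post h; simpa [_root_.closeCycles] using h
  | case3 c b => intro post h; simpa [_root_.closeCycles] using h
  | case4 c b a s hc ih =>
    intro post h
    rw [_root_.closeCycles, if_pos hc]
    have h' : Zigzag up (s.reverse ++ a :: b :: c :: x :: post) := by simpa using h
    obtain ⟨i1, i2⟩ := ih post (by simpa using h'.delete hc.1)
    refine ⟨i1, ?_⟩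
    have := hF.cycle s.reverse a b c x post (h'.closable hc.1 hc.2)
    simp only [List.reverse_cons, List.append_assoc, List.cons_append, List.nil_append,
      List.map_cons, List.sum_cons] at i2 ⊢
    rw [this, i2]; ring
  | case5 c b a s hc =>
    intro post h
    rw [_root_.closeCycles, if_neg hc]
    simpa using h

theorem RainflowAdditive.rainflowScan {F : List ℝ → ℝ} {g : ℝ → ℝ} (hF : RainflowAdditive F g)
    {up : Bool} (l : List ℝ) : ∀ stack : List ℝ, Zigzag up (stack.reverse ++ l) →
    Zigzag up (rainflowScan stack l).2.reverse ∧
    F (stack.reverse ++ l) =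
      ((rainflowScan stack l).1.map g).sum + F (rainflowScan stack l).2.reverse := by
  induction l with
  | nil => intro stack h; simpa [_root_.rainflowScan] using h
  | cons x l ih =>
    intro stack h
    obtain ⟨h1, h2⟩ := hF.closeCycles x stack l h
    obtain ⟨h3, h4⟩ := ih _ h1
    rw [_root_.rainflowScan]
    refine ⟨h3, ?_⟩
    rw [h2, h4]; simp; ring

/-- The profile is resolved by the rainflow method into its full cycles and its residue. -/
theorem RainflowAdditive.eq {F : List ℝ → ℝ} {g : ℝ → ℝ} (hF : RainflowAdditive F g)
    (x : List ℝ) : F x = ((fullCycles x).map g).sum + F (residue x).reverse := by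
  obtain ⟨up, h⟩ := exists_zigzag_turningPoints x
  have h1 := hF.turningPoints x []
  simp only [List.nil_append] at h1
  rw [← h1]
  exact (hF.rainflowScan (up := up) _ [] (by simpa using h)).2

/-- The ranges between consecutive points of a profile. -/
noncomputable def ranges (l : List ℝ) : List ℝ := List.zipWith (fun p q => |p - q|) l l.tail

theorem ranges_cons_cons (a b : ℝ) (l : List ℝ) :
    ranges (a :: b :: l) = |a - b| :: ranges (b :: l) :=
  rfl

theorem ranges_reverse (l : List ℝ) : ranges l.reverse = (ranges l).reverse := by
  have h : ∀ m : List ℝ, ranges m = List.zipWith (fun p q => |p - q|) m.dropLast m.tail := by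
    intro m
    induction m with
    | nil => rfl
    | cons a m ih =>
      cases m with
      | nil => rfl
      | cons b m =>
        rw [ranges_cons_cons, ih]; rfl
  rw [h, h, List.reverse_zipWith (by simp), List.zipWith_comm]
  simp only [List.tail_reverse, List.dropLast_reverse, abs_sub_comm]

theorem rainflowAdditive_sum_ranges : RainflowAdditive (fun l => (ranges l).sum)
    fun u => 2 * u where
  dup pre a := by
    induction pre with
    | nil => simp [ranges]
    | cons x pre ih =>
      cases pre with
      | nil => simp [ranges]
      | cons y pre => simpa [ranges_cons_cons] using ih
  between pre a b c post h := by
    induction pre with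
    | nil =>
      simp only [List.nil_append, ranges_cons_cons, List.sum_cons, ← add_assoc]
      congr 1
      rcases h with ⟨h1, h2⟩ | ⟨h1, h2⟩ <;> grind
    | cons x pre ih => cases pre <;> simpa [ranges_cons_cons] using ih
  cycle pre a b c d post h := by
    induction pre with
    | nil =>
      simp only [List.nil_append, ranges_cons_cons, List.sum_cons, ← add_assoc]
      congr 1
      obtain ⟨h1 | h1, h2, h3⟩ := h <;> grind
    | cons x pre ih =>
      cases pre <;> simp only [List.cons_append, List.nil_append, ranges_cons_cons, List.sum_cons]
        at ih ⊢ <;> linarith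

theorem stopVar_append_congr {s : ℝ} (hs : 0 ≤ s) {a : ℝ} {l l' : List ℝ} {δ : ℝ}
    (h : ∀ p, p ≤ a → a ≤ p + s → stopVar s p a l = δ + stopVar s p a l') (q : ℝ) (pre : List ℝ) :
    totalStopVar s q (pre ++ a :: l) = δ + totalStopVar s q (pre ++ a :: l') := by
  cases pre with
  | nil => exact h _ (playStep_le hs _ _) (le_playStep_add _ _ _)
  | cons x pre =>
    simp only [List.cons_append, totalStopVar]
    generalize playStep s q x = p
    induction pre generalizing p x with
    | nil =>
      simp only [List.nil_append, stopVar]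
      rw [h _ (playStep_le hs _ _) (le_playStep_add _ _ _)]; ring
    | cons y pre ih =>
      simp only [List.cons_append, stopVar]
      rw [ih]; ring

theorem rainflowAdditive_totalStopVar {s : ℝ} (hs : 0 ≤ s) (q : ℝ) :
    RainflowAdditive (totalStopVar s q) fun u => 2 * min u s where
  dup pre a := by
    rw [stopVar_append_congr (l' := []) (δ := 0) hs _ q pre, zero_add]
    intro p h1 h2
    simp [stopVar, playStep_eq_self h1 h2]
  between pre a b c post h := by
    rw [stopVar_append_congr (l' := c :: post) (δ := 0) hs _ q pre, zero_add]
    intro p h1 h2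
    obtain ⟨h3, h4⟩ := stop_between h1 h2 h
    simp only [stopVar]
    rw [← h4, h3]; ring
  cycle pre a b c d post h := by
    rw [stopVar_append_congr (l' := d :: post) (δ := 2 * min |c - b| s) hs _ q pre]
    intro p h1 h2
    obtain ⟨h3, h4⟩ := stop_cycle h1 h2 h
    simp only [stopVar]
    rw [← add_assoc (2 * _), ← h4, h3]; ring

theorem foldl_append_congr {s : ℝ} (hs : 0 ≤ s) {a : ℝ} {l l' : List ℝ}
    (h : ∀ p, p ≤ a → a ≤ p + s → l.foldl (playStep s) p = l'.foldl (playStep s) p)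
    (q : ℝ) (pre : List ℝ) :
    (pre ++ a :: l).foldl (playStep s) q = (pre ++ a :: l').foldl (playStep s) q := by
  rw [List.foldl_append, List.foldl_append, List.foldl_cons, List.foldl_cons]
  exact h _ (playStep_le hs _ _) (le_playStep_add _ _ _)

theorem rainflowAdditive_foldl_playStep {s : ℝ} (hs : 0 ≤ s) (q : ℝ) :
    RainflowAdditive (fun l => l.foldl (playStep s) q) fun _ => 0 where
  dup pre a := foldl_append_congr (l' := []) hs
    (fun p h1 h2 => by simp [playStep_eq_self h1 h2]) q pre
  between pre a b c post h := foldl_append_congr hs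
    (fun p h1 h2 => by simp [(stop_between h1 h2 h).1]) q pre
  cycle pre a b c d post h := by
    rw [zero_add]
    exact foldl_append_congr hs (fun p h1 h2 => by simp [(stop_cycle h1 h2 h).1]) q pre

/-! ### The residue -/

/-- No full cycle can be identified in the profile. -/
def RainflowIrreducible (l : List ℝ) : Prop :=
  ∀ pre a b c d post, l = pre ++ a :: b :: c :: d :: post →
    ¬ (|b - c| ≤ |a - b| ∧ |b - c| ≤ |c - d|)

theorem RainflowIrreducible.of_cons {x : ℝ} {l : List ℝ} (h : RainflowIrreducible (x :: l)) :
    RainflowIrreducible l :=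
  fun pre a b c d post hl => h (x :: pre) a b c d post (by rw [hl]; rfl)

theorem RainflowIrreducible.reverse {l : List ℝ} (h : RainflowIrreducible l) :
    RainflowIrreducible l.reverse := by
  intro pre a b c d post hl
  have := h post.reverse d c b a pre.reverse (by
    rw [← List.reverse_reverse l, hl]; simp)
  rw [abs_sub_comm b c, abs_sub_comm a b, abs_sub_comm c d]
  tauto

theorem RainflowIrreducible.head {a b c d : ℝ} {l : List ℝ}
    (h : RainflowIrreducible (a :: b :: c :: d :: l)) :
    ¬ (|b - c| ≤ |a - b| ∧ |b - c| ≤ |c - d|) := h [] a b c d l rfl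

theorem irreducible_of_length_lt {l : List ℝ} (h : l.length < 4) : RainflowIrreducible l := by
  intro pre a b c d post hl
  rw [hl] at h
  simp at h; omega

theorem irreducible_closeCycles (x : ℝ) (stack : List ℝ) (h : RainflowIrreducible stack) :
    RainflowIrreducible (closeCycles x stack).2 := by
  induction stack using closeCycles.induct (d := x) with
  | case1 => exact irreducible_of_length_lt (by simp [closeCycles])
  | case2 c => exact irreducible_of_length_lt (by simp [closeCycles])
  | case3 c b => exact irreducible_of_length_lt (by simp [closeCycles])
  | case4 c b a s hc ih =>
    rw [closeCycles, if_pos hc]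
    exact ih h.of_cons.of_cons
  | case5 c b a s hc =>
    rw [closeCycles, if_neg hc]
    intro pre a' b' c' d' post hl
    cases pre with
    | nil =>
      simp only [List.nil_append, List.cons.injEq] at hl
      obtain ⟨rfl, rfl, rfl, rfl, -⟩ := hl
      rw [abs_sub_comm c b, abs_sub_comm b a, abs_sub_comm x c, abs_sub_comm b c, abs_sub_comm a b,
        abs_sub_comm c x] at *
      grind
    | cons y pre =>
      simp only [List.cons_append, List.cons.injEq] at hl
      exact h pre a' b' c' d' post hl.2

theorem irreducible_rainflowScan (l : List ℝ) : ∀ stack, RainflowIrreducible stack →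
    RainflowIrreducible (rainflowScan stack l).2 := by
  induction l with
  | nil => intro stack h; simpa [rainflowScan] using h
  | cons x l ih => intro stack h; exact ih _ (irreducible_closeCycles x stack h)

theorem irreducible_residue (x : List ℝ) : RainflowIrreducible (residue x) :=
  irreducible_rainflowScan _ [] (irreducible_of_length_lt (by simp))

theorem zigzag_residue (x : List ℝ) : ∃ up, Zigzag up (residue x).reverse := by
  obtain ⟨up, h⟩ := exists_zigzag_turningPoints x
  exact ⟨up, ((rainflowAdditive_sum_ranges).rainflowScan _ [] (by simpa using h)).1⟩

/-- The play window `[p, p + s]` around `c` leaves enough room for the move from `c` to `d`: a move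
shorter than `s` stays inside the window, a longer one starts from its far end. -/
def Room (s p c d : ℝ) : Bool → Prop
  | true => min |c - d| s ≤ p + s - c
  | false => min |c - d| s ≤ c - p

/-- The sign of a direction. -/
def dirSign (up : Bool) : ℝ := if up then 1 else -1

theorem dirSign_not (up : Bool) : dirSign (!up) = - dirSign up := by cases up <;> simp [dirSign]

/-- A move with enough room changes the stop operator by its depth capped at `s`, shifts the window
by the rest, and leaves room for moving back. -/
theorem room_step {s p c d : ℝ} {up : Bool} (h1 : p ≤ c) (h2 : c ≤ p + s)
    (hz : if up then c ≤ d else d ≤ c) (hr : Room s p c d up) :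
    |d - playStep s p d - (c - p)| = min |c - d| s ∧
    dirSign up * (playStep s p d - p) = max (|c - d| - s) 0 ∧
    Room s (playStep s p d) d c (!up) := by
  cases up
  · simp only [Bool.false_eq_true, if_false] at hz
    simp only [Room, abs_sub_comm d c, Bool.not_false, dirSign, Bool.false_eq_true, if_false]
      at hr ⊢
    rw [stop_step_down h1 h2 hz, (playStep_down h1 h2 hz).1]
    rw [abs_of_nonneg (by linarith)] at hr ⊢
    simp only [max_def, min_def] at hr ⊢
    refine ⟨?_, ?_, ?_⟩ <;> split_ifs at hr ⊢ <;> linarith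
  · simp only [if_true] at hz
    simp only [Room, abs_sub_comm d c, Bool.not_true, dirSign, if_true] at hr ⊢
    rw [stop_step_up h1 h2 hz, (playStep_up h1 hz).1]
    rw [abs_of_nonpos (by linarith)] at hr ⊢
    simp only [max_def, min_def] at hr ⊢
    refine ⟨?_, ?_, ?_⟩ <;> split_ifs at hr ⊢ <;> linarith

theorem Room.mono {s p c d d' : ℝ} {up : Bool} (h : Room s p c d up) (hd : |c - d'| ≤ |c - d|) :
    Room s p c d' up := by
  cases up <;> exact (min_le_min_right s hd).trans h

/-- A move can be put in front of a longer one. -/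
theorem Room.prepend {s p' c d e : ℝ} {up : Bool} (h1 : p' ≤ d) (h2 : d ≤ p' + s)
    (hz : if up then c ≤ d else d ≤ c) (hr : Room s p' d e (!up)) (hd : |c - d| ≤ |d - e|) :
    ∃ p, p ≤ c ∧ c ≤ p + s ∧ Room s p c d up ∧ playStep s p d = p' := by
  have hr' : Room s p' d c (!up) := hr.mono (by rwa [abs_sub_comm d c])
  have key : ∀ p, p ≤ c → c ≤ p + s → (if up then max (d - s) p else min d p) = p' →
      playStep s p d = p' := by
    intro p h3 h4 h5
    cases up
    · rw [(playStep_down h3 h4 (by simpa using hz)).1]; simpa using h5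
    · rw [(playStep_up h3 (by simpa using hz)).1]; simpa using h5
  refine ⟨p' - dirSign up * max (|c - d| - s) 0, ?_, ?_, ?_, key _ ?_ ?_ ?_⟩ <;> clear key
  all_goals
    cases up
    · simp only [Bool.false_eq_true, if_false] at hz
      simp only [Room, abs_sub_comm d c, Bool.not_false, dirSign, Bool.false_eq_true, if_false]
        at hr' ⊢
      rw [abs_of_nonneg (by linarith)] at hr' ⊢
      simp only [max_def, min_def] at hr' ⊢
      split_ifs at hr' ⊢ <;> linarith
    · simp only [if_true] at hz
      simp only [Room, abs_sub_comm d c, Bool.not_true, dirSign, if_true] at hr' ⊢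
      rw [abs_of_nonpos (by linarith)] at hr' ⊢
      simp only [max_def, min_def] at hr' ⊢
      split_ifs at hr' ⊢ <;> linarith

/-- Along the part of an irreducible profile where the ranges decrease, every move finds enough
room. -/
theorem stopVar_of_decreasing {s : ℝ} (hs : 0 ≤ s) (l : List ℝ) : ∀ (c d p : ℝ) (up : Bool),
    RainflowIrreducible (c :: d :: l) → Zigzag up (c :: d :: l) →
    (∀ e ∈ l.head?, |d - e| ≤ |c - d|) → p ≤ c → c ≤ p + s → Room s p c d up →
    stopVar s p c (d :: l) = ((ranges (c :: d :: l)).map (min · s)).sum ∧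
    0 ≤ dirSign up * ((d :: l).foldl (playStep s) p - p) ∧
    dirSign up * ((d :: l).foldl (playStep s) p - p) ≤ max (|c - d| - s) 0 := by
  induction l with
  | nil =>
    intro c d p up hi hz hdec h1 h2 hr
    obtain ⟨h3, h4, -⟩ := room_step h1 h2 hz.1 hr
    refine ⟨by simpa [stopVar, ranges] using h3, ?_⟩
    simp [h4]
  | cons e l ih =>
    intro c d p up hi hz hdec h1 h2 hr
    obtain ⟨h3, h4, h5⟩ := room_step h1 h2 hz.1 hr
    have hde : |d - e| ≤ |c - d| := hdec e rfl
    obtain ⟨h6, h7, h8⟩ := ih d e (playStep s p d) (!up) hi.of_cons hz.2 (by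
      intro f hf
      cases l with
      | nil => simp at hf
      | cons f' l =>
        simp only [List.head?_cons, Option.mem_some_iff] at hf
        subst hf
        by_contra h
        exact hi.head ⟨hde, (not_le.1 h).le⟩) (playStep_le hs _ _) (le_playStep_add _ _ _)
      (h5.mono (by rwa [abs_sub_comm d c]))
    rw [stopVar, h6, h3, ranges_cons_cons c d]
    refine ⟨by simp, ?_⟩
    rw [dirSign_not] at h7 h8
    have h9 : max (|d - e| - s) 0 ≤ max (|c - d| - s) 0 := max_le_max_right _ (by linarith)
    rw [List.foldl_cons]
    constructor <;> linarith

/-- In an irreducible zigzag profile the ranges first increase and then decrease. For a suitable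
initial window, the stop operator therefore follows each range up to the depth `s`, and the shifts
of the window, which alternate in sign, add up to at most one of them. -/
theorem exists_stopVar_eq_of_irreducible {s : ℝ} (hs : 0 ≤ s) (l : List ℝ) :
    ∀ (c d : ℝ) (up : Bool), RainflowIrreducible (c :: d :: l) → Zigzag up (c :: d :: l) →
    ∃ p, p ≤ c ∧ c ≤ p + s ∧ Room s p c d up ∧
    stopVar s p c (d :: l) = ((ranges (c :: d :: l)).map (min · s)).sum ∧
    ∀ H, (∀ h ∈ ranges (c :: d :: l), h ≤ H) →
      max (|c - d| - s) 0 - max (H - s) 0 ≤ dirSign up * ((d :: l).foldl (playStep s) p - p) ∧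
      dirSign up * ((d :: l).foldl (playStep s) p - p) ≤ max (H - s) 0 := by
  have main : ∀ (l : List ℝ) (c d : ℝ) (up : Bool), RainflowIrreducible (c :: d :: l) →
      Zigzag up (c :: d :: l) → (∀ e ∈ l.head?, |d - e| ≤ |c - d|) →
      ∃ p, p ≤ c ∧ c ≤ p + s ∧ Room s p c d up ∧
      stopVar s p c (d :: l) = ((ranges (c :: d :: l)).map (min · s)).sum ∧
      ∀ H, (∀ h ∈ ranges (c :: d :: l), h ≤ H) →
        max (|c - d| - s) 0 - max (H - s) 0 ≤ dirSign up * ((d :: l).foldl (playStep s) p - p) ∧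
        dirSign up * ((d :: l).foldl (playStep s) p - p) ≤ max (H - s) 0 := by
    intro l c d up hi hz hdec
    have h : ∃ p, p ≤ c ∧ c ≤ p + s ∧ Room s p c d up := by
      cases up
      · exact ⟨c - s, by linarith, by linarith, by simp [Room]⟩
      · exact ⟨c, by linarith, by linarith, by simp [Room]⟩
    obtain ⟨p, h1, h2, h3⟩ := h
    obtain ⟨h4, h5, h6⟩ := stopVar_of_decreasing hs l c d p up hi hz hdec h1 h2 h3
    refine ⟨p, h1, h2, h3, h4, fun H hH => ?_⟩
    have h7 : max (|c - d| - s) 0 ≤ max (H - s) 0 :=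
      max_le_max_right _ (by linarith [hH |c - d| (by simp [ranges_cons_cons])])
    constructor <;> linarith
  induction l with
  | nil => intro c d up hi hz; exact main [] c d up hi hz (by simp)
  | cons e l ih =>
    intro c d up hi hz
    rcases le_total |d - e| |c - d| with hde | hde
    · exact main (e :: l) c d up hi hz (by simpa using hde)
    · obtain ⟨p', h1, h2, h3, h4, h5⟩ := ih d e (!up) hi.of_cons hz.2
      obtain ⟨p, h6, h7, h8, h9⟩ := h3.prepend h1 h2 hz.1 hde
      obtain ⟨h10, h11, -⟩ := room_step h6 h7 hz.1 h8
      refine ⟨p, h6, h7, h8, ?_, fun H hH => ?_⟩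
      · rw [stopVar, h10, h9, h4, ranges_cons_cons c d]; simp
      · obtain ⟨h12, h13⟩ := h5 H fun h hh => hH h (by
          rw [ranges_cons_cons c d]; exact List.mem_cons_of_mem _ hh)
        rw [dirSign_not] at h12 h13
        rw [h9] at h11
        have h14 : max (|c - d| - s) 0 ≤ max (|d - e| - s) 0 := max_le_max_right _ (by linarith)
        rw [List.foldl_cons, h9]
        constructor <;> linarith

theorem stopVar_le {s : ℝ} (hs : 0 ≤ s) (l : List ℝ) : ∀ p c, p ≤ c → c ≤ p + s →
    stopVar s p c l ≤ ((ranges (c :: l)).map (min · s)).sum := by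
  induction l with
  | nil => intro p c _ _; simp [stopVar, ranges]
  | cons d l ih =>
    intro p c h1 h2
    rw [stopVar, ranges_cons_cons, List.map_cons, List.sum_cons]
    refine add_le_add ?_ (ih _ _ (playStep_le hs _ _) (le_playStep_add _ _ _))
    rcases le_total c d with h | h
    · rw [stop_step_up h1 h2 h, abs_sub_comm, abs_of_nonneg (by linarith)]
      exact min_le_min_left _ (by linarith)
    · rw [stop_step_down h1 h2 h, abs_of_nonneg (by linarith)]
      exact min_le_min_left _ (by linarith)

/-! ### Rainflow sums -/

/-- The sum of `f` over all rainflow cycles, each full cycle being counted as two half cycles. -/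
noncomputable def rainflowSum (f : ℝ → ℝ) (x : List ℝ) : ℝ :=
  2 * ((fullCycles x).map f).sum + ((halfCycles x).map f).sum

theorem sum_map_halfCycles (f : ℝ → ℝ) (x : List ℝ) :
    ((halfCycles x).map f).sum = ((ranges (residue x).reverse).map f).sum := by
  rw [ranges_reverse, List.map_reverse, List.sum_reverse]; rfl

theorem mem_halfCycles {x : List ℝ} {h : ℝ} :
    h ∈ halfCycles x ↔ h ∈ ranges (residue x).reverse := by
  rw [ranges_reverse, List.mem_reverse]; rfl

theorem sum_map_two_mul (f : ℝ → ℝ) (l : List ℝ) :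
    (l.map fun u => 2 * f u).sum = 2 * (l.map f).sum := List.sum_map_mul_left _ _ _

theorem sum_ranges_eq_rainflowSum (x : List ℝ) :
    (ranges x).sum = rainflowSum (fun u => u) x := by
  rw [rainflowAdditive_sum_ranges.eq x, sum_map_two_mul, rainflowSum, sum_map_halfCycles]
  simp

theorem totalStopVar_le_rainflowSum {s : ℝ} (hs : 0 ≤ s) (p : ℝ) (x : List ℝ) :
    totalStopVar s p x ≤ rainflowSum (min · s) x := by
  rw [(rainflowAdditive_totalStopVar hs p).eq x, sum_map_two_mul, rainflowSum, sum_map_halfCycles]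
  gcongr
  cases (residue x).reverse with
  | nil => simp [totalStopVar, ranges]
  | cons c l => exact stopVar_le hs l _ c (playStep_le hs _ _) (le_playStep_add _ _ _)

theorem rainflowAdditive_headD : RainflowAdditive (fun l => l.headD 0) fun _ => 0 where
  dup pre a := by cases pre <;> rfl
  between pre a b c post _ := by cases pre <;> rfl
  cycle pre a b c d post _ := by cases pre <;> simp

/-- For a suitable initial window, the variation of the stop operator of width `s` is the sum of the
cycle depths capped at `s`, and the window rises by at most the excess over `s` of the deepest half
cycle. -/
theorem exists_totalStopVar_eq {s : ℝ} (hs : 0 ≤ s) (x : List ℝ) :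
    ∃ p, totalStopVar s p x = rainflowSum (min · s) x ∧
      (∀ H, (∀ h ∈ halfCycles x, h ≤ H) → x.foldl (playStep s) p - p ≤ max (H - s) 0) ∧
      p ≤ x.headD 0 ∧ x.headD 0 ≤ p + s := by
  suffices h : ∃ p, totalStopVar s p (residue x).reverse
        = ((ranges (residue x).reverse).map (min · s)).sum ∧
      (∀ H, (∀ h ∈ ranges (residue x).reverse, h ≤ H) →
        (residue x).reverse.foldl (playStep s) p - p ≤ max (H - s) 0) ∧
      p ≤ (residue x).reverse.headD 0 ∧ (residue x).reverse.headD 0 ≤ p + s by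
    obtain ⟨p, h1, h2, h3⟩ := h
    refine ⟨p, ?_, fun H hH => ?_, by
      have := rainflowAdditive_headD.eq x
      simp only [List.map_const', List.sum_replicate, smul_zero, zero_add] at this
      rwa [this]⟩
    · rw [(rainflowAdditive_totalStopVar hs p).eq x, sum_map_two_mul, rainflowSum,
        sum_map_halfCycles, h1]
    · rw [(rainflowAdditive_foldl_playStep hs p).eq x]
      simpa using h2 H fun h hh => hH h (mem_halfCycles.2 hh)
  obtain ⟨up, hz⟩ := zigzag_residue x
  have hi := (irreducible_residue x).reverse
  revert hz hi
  generalize (residue x).reverse = l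
  intro hz hi
  match l with
  | [] => exact ⟨0, by simp [totalStopVar, ranges, hs]⟩
  | [c] =>
    refine ⟨c, ?_⟩
    have h : playStep s c c = c := playStep_eq_self le_rfl (by linarith)
    simp [totalStopVar, stopVar, ranges, hs, h]
  | c :: d :: l =>
    obtain ⟨p, h1, h2, -, h4, h5⟩ := exists_stopVar_eq_of_irreducible hs l c d up hi hz
    refine ⟨p, ?_, fun H hH => ?_, by simp [h1, h2]⟩
    · rw [totalStopVar, playStep_eq_self h1 h2, h4]
    · obtain ⟨h6, h7⟩ := h5 H hH
      rw [List.foldl_cons, playStep_eq_self h1 h2]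
      have := le_max_right (|c - d| - s) 0
      cases up <;> simp only [dirSign, if_true, Bool.false_eq_true, if_false] at h6 h7 <;> linarith

/-! ### Variations of paths -/

/-- The total upward movement of the path `g` up to time `T`. The downward movement is the upward
movement of `-g`. -/
noncomputable def upVar (g : ℕ → ℝ) (T : ℕ) : ℝ :=
  ∑ t ∈ Finset.range T, max (g (t + 1) - g t) 0

theorem upVar_succ_of_le {g : ℕ → ℝ} {t : ℕ} (h : g t ≤ g (t + 1)) :
    upVar g (t + 1) = upVar g t + (g (t + 1) - g t) := by
  rw [upVar, Finset.sum_range_succ, max_eq_left (by linarith)]; rfl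

theorem upVar_succ_of_ge {g : ℕ → ℝ} {t : ℕ} (h : g (t + 1) ≤ g t) :
    upVar g (t + 1) = upVar g t := by
  rw [upVar, Finset.sum_range_succ, max_eq_right (by linarith), add_zero]; rfl

theorem upVar_sub_upVar_neg (g : ℕ → ℝ) (T : ℕ) : upVar g T - upVar (-g) T = g T - g 0 := by
  induction T with
  | zero => simp [upVar]
  | succ t ih =>
    rcases le_total (g t) (g (t + 1)) with h | h
    · rw [upVar_succ_of_le h, upVar_succ_of_ge (g := -g) (by simpa using h)]; linarith
    · rw [upVar_succ_of_ge h, upVar_succ_of_le (g := -g) (by simpa using h)]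
      simp only [Pi.neg_apply]; linarith

theorem upVar_add_upVar_neg (g : ℕ → ℝ) (T : ℕ) :
    upVar g T + upVar (-g) T = ∑ t ∈ Finset.range T, |g (t + 1) - g t| := by
  rw [upVar, upVar, ← Finset.sum_add_distrib]
  refine Finset.sum_congr rfl fun t _ => ?_
  rcases le_total (g t) (g (t + 1)) with h | h
  · rw [max_eq_left (by linarith), max_eq_right (by simp; linarith), abs_of_nonneg (by linarith),
      add_zero]
  · rw [max_eq_right (by linarith), max_eq_left (by simp; linarith), abs_of_nonpos (by linarith)]
    simp only [Pi.neg_apply]; ring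

/-- The play operator of width `s` along the path `x`, started from the window `[p, p + s]`. -/
noncomputable def playPath (s p : ℝ) (x : ℕ → ℝ) : ℕ → ℝ
  | 0 => p
  | t + 1 => playStep s (playPath s p x t) (x (t + 1))

/-- The stop operator along the path `x`: the position relative to the play window. -/
noncomputable def stopPath (s p : ℝ) (x : ℕ → ℝ) (t : ℕ) : ℝ := x t - playPath s p x t

theorem playPath_le {s p : ℝ} (hs : 0 ≤ s) {x : ℕ → ℝ} (h : p ≤ x 0) (t : ℕ) :
    playPath s p x t ≤ x t := by
  cases t with
  | zero => exact h
  | succ t => exact playStep_le hs _ _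

theorem le_playPath_add {s p : ℝ} {x : ℕ → ℝ} (h : x 0 ≤ p + s) (t : ℕ) :
    x t ≤ playPath s p x t + s := by
  cases t with
  | zero => exact h
  | succ t => exact le_playStep_add _ _ _

theorem playPath_shift (s p : ℝ) (x : ℕ → ℝ) (t : ℕ) :
    playPath s (playPath s p x 1) (fun i => x (i + 1)) t = playPath s p x (t + 1) := by
  induction t with
  | zero => rfl
  | succ t ih => rw [playPath, ih]; rfl

theorem ranges_map_range (x : ℕ → ℝ) (T : ℕ) :
    (ranges ((List.range (T + 1)).map x)).sum = ∑ t ∈ Finset.range T, |x (t + 1) - x t| := by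
  induction T generalizing x with
  | zero => simp [ranges]
  | succ T ih =>
    have := ih (fun i => x (i + 1))
    rw [Finset.sum_range_succ', ← this, List.range_succ_eq_map, List.range_succ_eq_map]
    simp [ranges_cons_cons, List.map_map, Function.comp_def, add_comm, abs_sub_comm]

theorem foldl_playStep_map_range {s p : ℝ} {x : ℕ → ℝ} (h1 : p ≤ x 0) (h2 : x 0 ≤ p + s) (T : ℕ) :
    ((List.range (T + 1)).map x).foldl (playStep s) p = playPath s p x T := by
  induction T with
  | zero => simp [playStep_eq_self h1 h2, playPath]
  | succ T ih =>
    rw [List.range_succ, List.map_append, List.foldl_append, ih]; rfl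

theorem stopVar_map_range (s p : ℝ) (x : ℕ → ℝ) (T : ℕ) :
    stopVar s p (x 0) ((List.range T).map fun i => x (i + 1)) =
      ∑ t ∈ Finset.range T, |stopPath s p x (t + 1) - stopPath s p x t| := by
  induction T generalizing x p with
  | zero => simp [stopVar]
  | succ T ih =>
    have := ih (playPath s p x 1) (fun i => x (i + 1))
    rw [Finset.sum_range_succ', List.range_succ_eq_map]
    simp only [stopPath, playPath_shift] at this ⊢
    rw [← this]
    simp only [List.map_cons, List.map_map, stopVar]
    rw [add_comm]; rfl

theorem totalStopVar_map_range {s p : ℝ} {x : ℕ → ℝ} (h1 : p ≤ x 0) (h2 : x 0 ≤ p + s) (T : ℕ) :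
    totalStopVar s p ((List.range (T + 1)).map x) =
      upVar (stopPath s p x) T + upVar (-stopPath s p x) T := by
  rw [upVar_add_upVar_neg, ← stopVar_map_range, List.range_succ_eq_map]
  simp [totalStopVar, playStep_eq_self h1 h2, List.map_map, Function.comp_def]

theorem stopPath_up {s p : ℝ} (hs : 0 ≤ s) {x : ℕ → ℝ} (h1 : p ≤ x 0) {t : ℕ}
    (h : x t ≤ x (t + 1)) :
    stopPath s p x (t + 1) - stopPath s p x t
      = min (x (t + 1) - x t) (s - stopPath s p x t) := by
  have := (playStep_up (s := s) (playPath_le hs h1 t) h).2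
  simp only [stopPath, playPath]
  rw [this]; congr 1; ring

theorem stopPath_down {s p : ℝ} (hs : 0 ≤ s) {x : ℕ → ℝ} (h1 : p ≤ x 0) (h2 : x 0 ≤ p + s) {t : ℕ}
    (h : x (t + 1) ≤ x t) :
    stopPath s p x t - stopPath s p x (t + 1)
      = min (x t - x (t + 1)) (stopPath s p x t) := by
  have := (playStep_down (playPath_le hs h1 t) (le_playPath_add h2 t) h).2
  simp only [stopPath, playPath]
  linarith

theorem stopPath_nonneg {s p : ℝ} (hs : 0 ≤ s) {x : ℕ → ℝ} (h1 : p ≤ x 0) (t : ℕ) :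
    0 ≤ stopPath s p x t := sub_nonneg.2 (playPath_le hs h1 t)

theorem stopPath_le {s p : ℝ} {x : ℕ → ℝ} (h2 : x 0 ≤ p + s) (t : ℕ) :
    stopPath s p x t ≤ s := by
  have := le_playPath_add h2 t
  unfold stopPath; linarith

theorem stopPath_step_up {s p : ℝ} (hs : 0 ≤ s) {x : ℕ → ℝ} (h1 : p ≤ x 0) (h2 : x 0 ≤ p + s)
    {t : ℕ} (h : x t ≤ x (t + 1)) :
    stopPath s p x t ≤ stopPath s p x (t + 1) ∧
    upVar (stopPath s p x) (t + 1) =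
      upVar (stopPath s p x) t + (stopPath s p x (t + 1) - stopPath s p x t) ∧
    upVar (-stopPath s p x) (t + 1) = upVar (-stopPath s p x) t := by
  have h3 := stopPath_up hs h1 h
  have h4 : stopPath s p x t ≤ stopPath s p x (t + 1) := by
    have : 0 ≤ min (x (t + 1) - x t) (s - stopPath s p x t) :=
      le_min (by linarith) (by linarith [stopPath_le h2 (t := t)])
    linarith
  exact ⟨h4, upVar_succ_of_le h4, upVar_succ_of_ge (by simpa using h4)⟩

theorem stopPath_step_down {s p : ℝ} (hs : 0 ≤ s) {x : ℕ → ℝ} (h1 : p ≤ x 0) (h2 : x 0 ≤ p + s)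
    {t : ℕ} (h : x (t + 1) ≤ x t) :
    stopPath s p x (t + 1) ≤ stopPath s p x t ∧
    upVar (stopPath s p x) (t + 1) = upVar (stopPath s p x) t ∧
    upVar (-stopPath s p x) (t + 1) =
      upVar (-stopPath s p x) t + (stopPath s p x t - stopPath s p x (t + 1)) := by
  have h3 := stopPath_down hs h1 h2 h
  have h4 : stopPath s p x (t + 1) ≤ stopPath s p x t := by
    have : 0 ≤ min (x t - x (t + 1)) (stopPath s p x t) :=
      le_min (by linarith) (stopPath_nonneg hs h1 t)
    linarith
  refine ⟨h4, upVar_succ_of_ge h4, ?_⟩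
  rw [upVar_succ_of_le (by simpa using h4)]
  simp only [Pi.neg_apply]; ring

theorem upVar_stopPath_le {s p : ℝ} (hs : 0 ≤ s) {x : ℕ → ℝ} (h1 : p ≤ x 0) (h2 : x 0 ≤ p + s)
    (T : ℕ) : upVar (stopPath s p x) T ≤ upVar x T ∧ upVar (-stopPath s p x) T ≤ upVar (-x) T := by
  induction T with
  | zero => simp [upVar]
  | succ t ih =>
    rcases le_total (x t) (x (t + 1)) with h | h
    · obtain ⟨-, h3, h4⟩ := stopPath_step_up hs h1 h2 h
      have h5 := stopPath_up hs h1 h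
      rw [h3, h4, upVar_succ_of_le h, upVar_succ_of_ge (g := -x) (by simpa using h)]
      exact ⟨add_le_add ih.1 (h5.trans_le (min_le_left _ _)), ih.2⟩
    · obtain ⟨-, h3, h4⟩ := stopPath_step_down hs h1 h2 h
      have h5 := stopPath_down hs h1 h2 h
      rw [h3, h4, upVar_succ_of_ge h, upVar_succ_of_le (g := -x) (by simpa using h)]
      refine ⟨ih.1, add_le_add ih.2 (h5.trans_le ((min_le_left _ _).trans ?_))⟩
      simp only [Pi.neg_apply]; linarith

theorem playPath_eq_of_forall {s p : ℝ} {x : ℕ → ℝ} {T : ℕ}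
    (h : ∀ t ≤ T, p ≤ x t ∧ x t ≤ p + s) : ∀ t ≤ T, playPath s p x t = p := by
  intro t
  induction t with
  | zero => intro _; rfl
  | succ t ih =>
    intro ht
    rw [playPath, ih (by omega), playStep_eq_self (h _ ht).1 (h _ ht).2]

theorem upVar_stopPath_eq {s p : ℝ} {x : ℕ → ℝ} {T : ℕ}
    (h : ∀ t ≤ T, p ≤ x t ∧ x t ≤ p + s) :
    upVar (stopPath s p x) T = upVar x T ∧ upVar (-stopPath s p x) T = upVar (-x) T := by
  have h1 := playPath_eq_of_forall h
  constructor <;>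
  · refine Finset.sum_congr rfl fun t ht => ?_
    rw [Finset.mem_range] at ht
    simp only [stopPath, Pi.neg_apply, h1 t ht.le, h1 (t + 1) ht]
    congr 1; ring

theorem playPath_neg {s p : ℝ} (hs : 0 ≤ s) (x : ℕ → ℝ) (t : ℕ) :
    playPath s (-p - s) (-x) t = - playPath s p x t - s := by
  induction t with
  | zero => rfl
  | succ t ih =>
    rw [playPath, ih, playPath]
    simp only [playStep, Pi.neg_apply, max_def, min_def]
    split_ifs <;> linarith

theorem upVar_stopPath_neg {s p : ℝ} (hs : 0 ≤ s) (x : ℕ → ℝ) (T : ℕ) :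
    upVar (stopPath s (-p - s) (-x)) T = upVar (-stopPath s p x) T ∧
    upVar (-stopPath s (-p - s) (-x)) T = upVar (stopPath s p x) T := by
  constructor <;>
  · refine Finset.sum_congr rfl fun t _ => ?_
    simp only [Pi.neg_apply, stopPath, playPath_neg hs]
    congr 1; ring

/-! ### Comparing a path with a dominating one -/

/-- In the step from `t` both paths move upwards, and `y` moves at least as much as `x`, unless it
is blocked. When blocked, `y` ends at its largest level up to the horizon `T`, and this level is not
below `x` or exceeds an earlier level of `y` by the width `w`. -/
def DominatedUp (w : ℝ) (T : ℕ) (x y : ℕ → ℝ) (t : ℕ) : Prop :=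
  x t ≤ x (t + 1) ∧ y t ≤ y (t + 1) ∧ (x (t + 1) - x t ≤ y (t + 1) - y t ∨
    ((∀ i ≤ T, y i ≤ y (t + 1)) ∧ (x (t + 1) ≤ y (t + 1) ∨ ∃ j ≤ t, y j + w ≤ y (t + 1))))

/-- The path `y` stays in a range of width `w`, and apart from that moves at least as much as `x`
in the same direction, until it is blocked. -/
structure Dominated (w : ℝ) (T : ℕ) (x y : ℕ → ℝ) : Prop where
  zero : x 0 = y 0
  range_le : ∀ i ≤ T, ∀ j ≤ T, y i - y j ≤ w
  step : ∀ t < T, DominatedUp w T x y t ∨ DominatedUp w T (-x) (-y) t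

theorem Dominated.neg {w : ℝ} {T : ℕ} {x y : ℕ → ℝ} (h : Dominated w T x y) :
    Dominated w T (-x) (-y) where
  zero := by simp [h.zero]
  range_le i hi j hj := by have := h.range_le j hj i hi; simp only [Pi.neg_apply]; linarith
  step t ht := by simpa [or_comm] using h.step t ht

theorem DominatedUp.upVar_le {w : ℝ} {T t : ℕ} {x y : ℕ → ℝ} (h : DominatedUp w T x y t)
    (h0 : x 0 = y 0) (hw : ∀ i ≤ t + 1, ∀ j ≤ t + 1, y i - y j < w)
    (h1 : upVar x t ≤ upVar y t) (h2 : upVar (-x) t ≤ upVar (-y) t) :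
    upVar x (t + 1) ≤ upVar y (t + 1) ∧ upVar (-x) (t + 1) ≤ upVar (-y) (t + 1) := by
  obtain ⟨hx, hy, h⟩ := h
  have e1 := upVar_succ_of_ge (g := -x) (by simpa using hx)
  have e2 := upVar_succ_of_ge (g := -y) (by simpa using hy)
  refine ⟨?_, by rwa [e1, e2]⟩
  rcases h with h | ⟨-, h | ⟨j, hj, h⟩⟩
  · rw [upVar_succ_of_le hx, upVar_succ_of_le hy]; linarith
  · have := upVar_sub_upVar_neg x (t + 1)
    have := upVar_sub_upVar_neg y (t + 1)
    linarith
  · have := hw (t + 1) le_rfl j (by omega)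
    linarith

/-- As long as the range of the dominating path is below `w`, its upward and downward movements are
at least those of the dominated path. -/
theorem Dominated.upVar_le {w : ℝ} {T : ℕ} {x y : ℕ → ℝ} (h : Dominated w T x y) (t : ℕ)
    (ht : t ≤ T) (hw : ∀ i ≤ t, ∀ j ≤ t, y i - y j < w) :
    upVar x t ≤ upVar y t ∧ upVar (-x) t ≤ upVar (-y) t := by
  induction t with
  | zero => simp [upVar]
  | succ t ih =>
    obtain ⟨h1, h2⟩ := ih (by omega) fun i hi j hj => hw i (by omega) j (by omega)
    rcases h.step t (by omega) with h' | h'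
    · exact h'.upVar_le h.zero hw h1 h2
    · have := h'.upVar_le (by simp [h.zero]) (fun i hi j hj => by
        have := hw j hj i hi
        simp only [Pi.neg_apply]; linarith) h2 (by simpa using h1)
      simpa [and_comm] using this

/-- The window of the play operator stays within the range of the path if it starts there. -/
theorem playPath_bounds {s q : ℝ} {y : ℕ → ℝ} {m M : ℝ} {T : ℕ} (hy : ∀ i ≤ T, m ≤ y i ∧ y i ≤ M)
    (h1 : m ≤ q) (h2 : q + s ≤ M) : ∀ t ≤ T, m ≤ playPath s q y t ∧ playPath s q y t + s ≤ M := by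
  intro t
  induction t with
  | zero => intro _; exact ⟨h1, h2⟩
  | succ t ih =>
    intro ht
    obtain ⟨h3, h4⟩ := ih (by omega)
    obtain ⟨h5, h6⟩ := hy (t + 1) ht
    rw [playPath, playStep]
    refine ⟨le_max_of_le_right (le_min h5 h3), ?_⟩
    have := min_le_right (y (t + 1)) (playPath s q y t)
    have : max (y (t + 1) - s) (min (y (t + 1)) (playPath s q y t)) ≤ M - s :=
      max_le (by linarith) (by linarith)
    linarith

/-- Once the play window of the dominating path lies within its range, the lead `l₀` in upward
movement and `m₀` in downward movement of the stop operators persists. -/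
theorem Dominated.stop_persist {w s p q : ℝ} {T : ℕ} {x y : ℕ → ℝ} (h : Dominated w T x y)
    (hs : 0 ≤ s) (hp1 : p ≤ x 0) (hp2 : x 0 ≤ p + s) (hq1 : q ≤ y 0) (hq2 : y 0 ≤ q + s)
    (hlo : ∀ t ≤ T, ∃ i ≤ T, y i ≤ playPath s q y t)
    (hhi : ∀ t ≤ T, ∃ i ≤ T, playPath s q y t + s ≤ y i)
    {l₀ m₀ : ℝ} (h₀ : l₀ - m₀ = stopPath s p x 0 - stopPath s q y 0) {t₁ : ℕ}
    (hl : l₀ ≤ upVar (stopPath s q y) t₁ - upVar (stopPath s p x) t₁)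
    (hm : m₀ ≤ upVar (-stopPath s q y) t₁ - upVar (-stopPath s p x) t₁)
    (t : ℕ) (ht₁ : t₁ ≤ t) (ht : t ≤ T) :
    l₀ ≤ upVar (stopPath s q y) t - upVar (stopPath s p x) t ∧
    m₀ ≤ upVar (-stopPath s q y) t - upVar (-stopPath s p x) t := by
  induction t, ht₁ using Nat.le_induction with
  | base => exact ⟨hl, hm⟩
  | succ t ht₁ ih =>
    obtain ⟨h1, h2⟩ := ih (by omega)
    have b1 := stopPath_nonneg hs hp1 (t + 1)
    have b2 := stopPath_le hp2 (t + 1)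
    have e1 := upVar_sub_upVar_neg (stopPath s p x) (t + 1)
    have e2 := upVar_sub_upVar_neg (stopPath s q y) (t + 1)
    rcases h.step t (by omega) with ⟨hx, hy, h'⟩ | ⟨hx, hy, h'⟩
    · obtain ⟨-, f1, f2⟩ := stopPath_step_up hs hp1 hp2 hx
      obtain ⟨-, f3, f4⟩ := stopPath_step_up hs hq1 hq2 hy
      have g1 := stopPath_up hs hp1 hx
      have g2 := stopPath_up hs hq1 hy
      refine ⟨?_, by linarith⟩
      by_cases hc : x (t + 1) - x t ≤ y (t + 1) - y t ∧ y (t + 1) - y t ≤ s - stopPath s q y t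
      · rw [min_eq_left hc.2] at g2
        have := min_le_left (x (t + 1) - x t) (s - stopPath s p x t)
        linarith [hc.1]
      · have htop : stopPath s q y (t + 1) = s := by
          rcases le_total (s - stopPath s q y t) (y (t + 1) - y t) with h3 | h3
          · rw [min_eq_right h3] at g2; linarith
          · rcases h' with h' | ⟨h', -⟩
            · exact absurd ⟨h', h3⟩ hc
            · obtain ⟨i, hi, h5⟩ := hhi t (by omega)
              have := h' i hi
              simp only [stopPath] at h3 g2 ⊢
              rw [min_eq_left h3] at g2
              linarith
        linarith
    · simp only [Pi.neg_apply, neg_le_neg_iff] at hx hy h'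
      obtain ⟨-, f1, f2⟩ := stopPath_step_down hs hp1 hp2 hx
      obtain ⟨-, f3, f4⟩ := stopPath_step_down hs hq1 hq2 hy
      have g1 := stopPath_down hs hp1 hp2 hx
      have g2 := stopPath_down hs hq1 hq2 hy
      refine ⟨by linarith, ?_⟩
      by_cases hc : x t - x (t + 1) ≤ y t - y (t + 1) ∧ y t - y (t + 1) ≤ stopPath s q y t
      · rw [min_eq_left hc.2] at g2
        have := min_le_left (x t - x (t + 1)) (stopPath s p x t)
        linarith [hc.1]
      · have hbot : stopPath s q y (t + 1) = 0 := by
          rcases le_total (stopPath s q y t) (y t - y (t + 1)) with h3 | h3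
          · rw [min_eq_right h3] at g2; linarith
          · rcases h' with h' | ⟨h', -⟩
            · exact absurd ⟨by linarith, h3⟩ hc
            · obtain ⟨i, hi, h5⟩ := hlo t (by omega)
              have := h' i hi
              simp only [stopPath] at h3 g2 ⊢
              rw [min_eq_left h3] at g2
              linarith
        linarith

/-- The play window of `y` started at `q` serves in the comparison with every window of `x`. -/
def GoodWindow (w s : ℝ) (T : ℕ) (x y : ℕ → ℝ) (q : ℝ) : Prop :=
  q ≤ y 0 ∧ y 0 ≤ q + s ∧ |playPath s q y T - q| ≤ w - s ∧
  ∀ p, p ≤ x 0 → x 0 ≤ p + s →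
    upVar (stopPath s p x) T ≤ upVar (stopPath s q y) T ∧
    upVar (-stopPath s p x) T ≤ upVar (-stopPath s q y) T

theorem GoodWindow.of_neg {w s : ℝ} (hs : 0 ≤ s) {T : ℕ} {x y : ℕ → ℝ} {q : ℝ}
    (h : GoodWindow w s T (-x) (-y) q) : GoodWindow w s T x y (-q - s) := by
  obtain ⟨h1, h2, h3, h4⟩ := h
  simp only [Pi.neg_apply] at h1 h2
  have e : - (-q - s) - s = q := by ring
  have e1 := playPath_neg (p := -q - s) hs y T
  have e2 := upVar_stopPath_neg (p := -q - s) hs y T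
  rw [e] at e1 e2
  refine ⟨by linarith, by linarith, ?_, fun p hp1 hp2 => ?_⟩
  · rw [abs_sub_comm]; convert h3 using 2; linarith
  · have := h4 (-p - s) (by simp only [Pi.neg_apply]; linarith)
      (by simp only [Pi.neg_apply]; linarith)
    rw [(upVar_stopPath_neg hs x T).1, (upVar_stopPath_neg hs x T).2, e2.1, e2.2] at this
    exact this.symm

/-- If the range of `y` first reaches `s` by an upward move at time `t₁`, the right window starts at
the lowest level up to then. When this level is attained, `y` has used up every possible advantage
of `x` in downward movement, and at time `t₁` every possible advantage in upward movement. -/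
theorem Dominated.goodWindow_of_up {w s : ℝ} {T : ℕ} {x y : ℕ → ℝ} (h : Dominated w T x y)
    (hs : 0 ≤ s) (hsw : s ≤ w) {t₁ j : ℕ} (ht₁ : t₁ ≤ T)
    (hlt : ∀ i < t₁, ∀ j < t₁, y i - y j < s) (hj : j ≤ t₁) (hjmin : ∀ i ≤ t₁, y j ≤ y i)
    (hreach : s ≤ y t₁ - y j) : GoodWindow w s T x y (y j) := by
  have hq1 : y j ≤ y 0 := hjmin 0 (by omega)
  have hq2 : y 0 ≤ y j + s := by
    rcases Nat.eq_zero_or_pos t₁ with h0 | h0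
    · obtain rfl : j = 0 := by omega
      linarith
    · rcases hj.lt_or_eq with hj' | rfl
      · linarith [hlt 0 h0 j hj']
      · linarith [hjmin 0 (by omega), hlt 0 h0 0 h0]
  obtain ⟨a, ha, hamin⟩ := (Finset.range (T + 1)).exists_min_image y ⟨0, by simp⟩
  obtain ⟨b, hb, hbmax⟩ := (Finset.range (T + 1)).exists_max_image y ⟨0, by simp⟩
  simp only [Finset.mem_range, Nat.lt_succ_iff] at ha hamin hb hbmax
  have hbd := playPath_bounds (q := y j) (s := s) (fun i hi => ⟨hamin i hi, hbmax i hi⟩)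
    (hamin j (by omega)) (by linarith [hbmax t₁ ht₁])
  refine ⟨hq1, hq2, ?_, fun p hp1 hp2 => ?_⟩
  · have h1 := hbd T le_rfl
    have h2 := hbd 0 (by omega)
    have h3 := h.range_le b hb a ha
    simp only [playPath] at h2
    rw [abs_le]; constructor <;> linarith
  have key : ∃ l₀ m₀ : ℝ, 0 ≤ l₀ ∧ 0 ≤ m₀ ∧
      l₀ - m₀ = stopPath s p x 0 - stopPath s (y j) y 0 ∧
      m₀ ≤ upVar (-stopPath s (y j) y) t₁ - upVar (-stopPath s p x) t₁ ∧
      stopPath s (y j) y t₁ = s := by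
    refine ⟨max (stopPath s p x 0 - stopPath s (y j) y 0) 0,
      max (stopPath s (y j) y 0 - stopPath s p x 0) 0, le_max_right _ _, le_max_right _ _, ?_, ?_⟩
    · rw [max_def, max_def]; split_ifs <;> linarith
    generalize hm₀ : max (stopPath s (y j) y 0 - stopPath s p x 0) 0 = m₀
    rcases Nat.eq_zero_or_pos t₁ with rfl | hpos
    · obtain rfl : j = 0 := by omega
      have b1 := stopPath_nonneg hs hp1 0
      have b2 := stopPath_le hp2 0
      have b3 : stopPath s (y 0) y 0 = 0 := by simp [stopPath, playPath]
      rw [b3] at hm₀ ⊢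
      rw [max_eq_right (by linarith)] at hm₀
      refine ⟨by simp [upVar, ← hm₀], by linarith⟩
    · have hj' : j < t₁ := by
        rcases hj.lt_or_eq with hj' | rfl
        · exact hj'
        · linarith [hlt 0 hpos 0 hpos]
      have hin : ∀ t < t₁, y j ≤ y t ∧ y t < y j + s := fun t ht =>
        ⟨hjmin t ht.le, by linarith [hlt t ht j hj']⟩
      have hplay : ∀ t < t₁, playPath s (y j) y t = y j := fun t ht =>
        playPath_eq_of_forall (T := t₁ - 1)
          (fun i hi => ⟨(hin i (by omega)).1, (hin i (by omega)).2.le⟩) t (by omega)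
      have hlead : ∀ t < t₁, upVar (stopPath s p x) t ≤ upVar (stopPath s (y j) y) t ∧
          upVar (-stopPath s p x) t ≤ upVar (-stopPath s (y j) y) t := by
        intro t ht
        obtain ⟨e1, e2⟩ := upVar_stopPath_eq (s := s) (p := y j) (x := y) (T := t)
          fun i hi => ⟨(hin i (by omega)).1, (hin i (by omega)).2.le⟩
        obtain ⟨e3, e4⟩ := h.upVar_le t (by omega)
          fun i hi k hk => (hlt i (by omega) k (by omega)).trans_le hsw
        obtain ⟨e5, e6⟩ := upVar_stopPath_le hs hp1 hp2 t
        constructor <;> linarith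
      -- whenever the stop of `y` is at its bottom, `y` leads by `m₀` in downward movement
      have hbot : ∀ t < t₁, stopPath s (y j) y t = 0 →
          m₀ ≤ upVar (-stopPath s (y j) y) t - upVar (-stopPath s p x) t := by
        intro t ht h0
        have e1 := upVar_sub_upVar_neg (stopPath s p x) t
        have e2 := upVar_sub_upVar_neg (stopPath s (y j) y) t
        have b1 := stopPath_nonneg hs hp1 t
        obtain ⟨h1, h2⟩ := hlead t ht
        rw [← hm₀]
        exact max_le (by linarith) (by linarith)
      have hafter : ∀ t, j ≤ t → t < t₁ →
          m₀ ≤ upVar (-stopPath s (y j) y) t - upVar (-stopPath s p x) t := by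
        intro t hjt
        induction t, hjt using Nat.le_induction with
        | base => exact fun ht => hbot j ht (by simp [stopPath, hplay j ht])
        | succ t hjt ih =>
          intro ht
          have ih := ih (by omega)
          rcases h.step t (by omega) with ⟨hx, hy, h'⟩ | ⟨hx, hy, h'⟩
          · rw [(stopPath_step_up hs hp1 hp2 hx).2.2, (stopPath_step_up hs hq1 hq2 hy).2.2]
            exact ih
          · simp only [Pi.neg_apply, neg_le_neg_iff] at hx hy h'
            rcases h' with h' | ⟨h', -⟩
            · rw [(stopPath_step_down hs hp1 hp2 hx).2.2, (stopPath_step_down hs hq1 hq2 hy).2.2]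
              have g1 := stopPath_down hs hp1 hp2 hx
              have g2 := min_le_left (x t - x (t + 1)) (stopPath s p x t)
              have g3 : stopPath s (y j) y t - stopPath s (y j) y (t + 1) = y t - y (t + 1) := by
                simp only [stopPath, hplay t (by omega), hplay (t + 1) ht]; ring
              linarith
            · refine hbot _ ht ?_
              have := h' j (by omega)
              simp only [stopPath, hplay (t + 1) ht]
              linarith [(hin (t + 1) ht).1]
      obtain ⟨t, rfl⟩ : ∃ t, t₁ = t + 1 := ⟨t₁ - 1, by omega⟩
      have hyt := (hin t (by omega)).2
      constructor
      · rcases h.step t (by omega) with ⟨hx, hy, -⟩ | ⟨-, hy, -⟩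
        · rw [(stopPath_step_up hs hp1 hp2 hx).2.2, (stopPath_step_up hs hq1 hq2 hy).2.2]
          exact hafter t (by omega) (by omega)
        · simp only [Pi.neg_apply, neg_le_neg_iff] at hy
          linarith
      · rw [stopPath, playPath, hplay t (by omega), playStep, max_eq_left]
        · ring
        · exact (min_le_right _ _).trans (by linarith)
  obtain ⟨l₀, m₀, hl₀, hm₀, h₀, hm, htop⟩ := key
  have e1 := upVar_sub_upVar_neg (stopPath s p x) t₁
  have e2 := upVar_sub_upVar_neg (stopPath s (y j) y) t₁
  have b2 := stopPath_le hp2 t₁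
  obtain ⟨h1, h2⟩ := h.stop_persist hs hp1 hp2 hq1 hq2
    (fun t ht => ⟨a, ha, (hbd t ht).1⟩) (fun t ht => ⟨b, hb, (hbd t ht).2⟩) h₀
    (by linarith) hm T ht₁ le_rfl
  constructor <;> linarith

/-- For every width `s ≤ w`, the stop operator of the dominating path, started suitably, moves at
least as much in both directions as that of the dominated path. -/
theorem Dominated.exists_goodWindow {w s : ℝ} {T : ℕ} {x y : ℕ → ℝ} (h : Dominated w T x y)
    (hs : 0 ≤ s) (hsw : s ≤ w) : ∃ q, GoodWindow w s T x y q := by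
  classical
  by_cases hex : ∃ t, t ≤ T ∧ ∃ i ≤ t, ∃ j ≤ t, s ≤ y i - y j
  · obtain ⟨ht₁, i, hi, j, hj, hij⟩ := Nat.find_spec hex
    have hlt : ∀ i < Nat.find hex, ∀ j < Nat.find hex, y i - y j < s := by
      intro i hi j hj
      by_contra hc
      exact Nat.find_min hex (m := max i j) (max_lt hi hj)
        ⟨by omega, i, le_max_left _ _, j, le_max_right _ _, not_lt.1 hc⟩
    generalize Nat.find hex = t₁ at *
    obtain ⟨a, ha, hamin⟩ := (Finset.range (t₁ + 1)).exists_min_image y ⟨0, by simp⟩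
    obtain ⟨b, hb, hbmax⟩ := (Finset.range (t₁ + 1)).exists_max_image y ⟨0, by simp⟩
    simp only [Finset.mem_range, Nat.lt_succ_iff] at ha hamin hb hbmax
    have hab : s ≤ y b - y a := by linarith [hamin j hj, hbmax i hi]
    -- the range is first reached at time `t₁`, so one of the extreme levels is attained there
    have hend : y t₁ = y b ∨ y t₁ = y a := by
      by_contra hc
      rw [not_or] at hc
      have hb' : b ≠ t₁ := by rintro rfl; exact hc.1 rfl
      have ha' : a ≠ t₁ := by rintro rfl; exact hc.2 rfl
      linarith [hlt b (by omega) a (by omega)]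
    rcases hend with he | he
    · exact ⟨_, h.goodWindow_of_up hs hsw ht₁ hlt ha hamin (by rw [he]; exact hab)⟩
    · refine ⟨_, GoodWindow.of_neg hs (h.neg.goodWindow_of_up hs hsw ht₁ (fun i hi j hj => ?_) hb
        (fun i hi => ?_) ?_)⟩
      · have := hlt j hj i hi
        simp only [Pi.neg_apply]; linarith
      · simpa using hbmax i hi
      · simp only [Pi.neg_apply]; linarith
  · have hlt : ∀ i ≤ T, ∀ j ≤ T, y i - y j < s := by
      intro i hi j hj
      by_contra hc
      exact hex ⟨T, le_rfl, i, hi, j, hj, not_lt.1 hc⟩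
    obtain ⟨a, ha, hamin⟩ := (Finset.range (T + 1)).exists_min_image y ⟨0, by simp⟩
    simp only [Finset.mem_range, Nat.lt_succ_iff] at ha hamin
    have hin : ∀ i ≤ T, y a ≤ y i ∧ y i ≤ y a + s := fun i hi =>
      ⟨hamin i hi, by linarith [hlt i hi a ha]⟩
    obtain ⟨e1, e2⟩ := upVar_stopPath_eq hin
    obtain ⟨e3, e4⟩ := h.upVar_le T le_rfl fun i hi j hj => (hlt i hi j hj).trans_le hsw
    refine ⟨y a, (hin 0 (by omega)).1, (hin 0 (by omega)).2, ?_, fun p hp1 hp2 => ?_⟩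
    · simp [playPath_eq_of_forall hin T le_rfl, hsw]
    · obtain ⟨e5, e6⟩ := upVar_stopPath_le hs hp1 hp2 T
      constructor <;> linarith

/-- The cycle depths capped at `s` of a dominated path have at most the sum that those of the
dominating path have; and the final level of the dominated path can only be higher to the extent
that this sum is smaller, that `s` is below `w`, or that a half cycle exceeds `w`. -/
theorem Dominated.rainflowSum_min_le {w s : ℝ} {T : ℕ} {x y : ℕ → ℝ} (h : Dominated w T x y)
    (hs : 0 ≤ s) (hsw : s ≤ w) :
    rainflowSum (min · s) ((List.range (T + 1)).map x)
      ≤ rainflowSum (min · s) ((List.range (T + 1)).map y) ∧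
    ∀ H, (∀ u ∈ halfCycles ((List.range (T + 1)).map x), u ≤ H) →
      rainflowSum (min · s) ((List.range (T + 1)).map x) + (x T - y T)
        ≤ rainflowSum (min · s) ((List.range (T + 1)).map y) + max (H - w) 0 + 2 * (w - s) := by
  obtain ⟨q, hq1, hq2, hq3, hq⟩ := h.exists_goodWindow hs hsw
  obtain ⟨p, hp, hpH, hp1, hp2⟩ := exists_totalStopVar_eq hs ((List.range (T + 1)).map x)
  have hhead : ((List.range (T + 1)).map x).headD 0 = x 0 := by
    rw [List.range_succ_eq_map]; rfl
  rw [hhead] at hp1 hp2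
  obtain ⟨h1, h2⟩ := hq p hp1 hp2
  have hle := totalStopVar_le_rainflowSum hs q ((List.range (T + 1)).map y)
  rw [totalStopVar_map_range hp1 hp2] at hp
  rw [totalStopVar_map_range hq1 hq2] at hle
  refine ⟨by linarith, fun H hH => ?_⟩
  have hd := hpH H hH
  rw [foldl_playStep_map_range hp1 hp2] at hd
  have e1 := upVar_sub_upVar_neg (stopPath s p x) T
  have e2 := upVar_sub_upVar_neg (stopPath s q y) T
  have e3 := neg_abs_le (playPath s q y T - q)
  have e4 : max (H - s) 0 ≤ max (H - w) 0 + (w - s) :=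
    max_le (by linarith [le_max_left (H - w) 0]) (by linarith [le_max_right (H - w) 0])
  have e5 := h.zero
  simp only [stopPath, playPath] at e1 e2
  linarith

/-! ### Depths of the rainflow cycles -/

theorem turningPoints_subset (l : List ℝ) : ∀ u ∈ turningPoints l, u ∈ l := by
  induction l using turningPoints.induct with
  | case1 => simp [turningPoints]
  | case2 a => simp [turningPoints]
  | case3 a => simp [turningPoints]
  | case4 a b h => simp [turningPoints, h]
  | case5 a b c l h ih =>
    rw [turningPoints, if_pos h]
    intro u hu
    have := ih u hu
    simp only [List.mem_cons] at this ⊢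
    tauto
  | case6 a b c l h ih =>
    rw [turningPoints, if_neg h]
    intro u hu
    rcases List.mem_cons.1 hu with rfl | hu
    · simp
    · exact List.mem_cons_of_mem _ (ih u hu)

theorem closeCycles_spec {P : ℝ → Prop} (x : ℝ) (hx : P x) (stack : List ℝ)
    (h : ∀ u ∈ stack, P u) : (∀ u ∈ (closeCycles x stack).2, P u) ∧
      ∀ u ∈ (closeCycles x stack).1, ∃ a b, P a ∧ P b ∧ u = |a - b| := by
  induction stack using closeCycles.induct (d := x) with
  | case1 => simpa [closeCycles] using hx
  | case2 c => simp_all [closeCycles]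
  | case3 c b => simp_all [closeCycles]
  | case4 c b a s hc ih =>
    rw [closeCycles, if_pos hc]
    obtain ⟨h1, h2⟩ := ih fun u hu => h u (List.mem_cons_of_mem _ (List.mem_cons_of_mem _ hu))
    refine ⟨h1, fun u hu => ?_⟩
    rcases List.mem_cons.1 hu with rfl | hu
    · exact ⟨c, b, h c (by simp), h b (by simp), rfl⟩
    · exact h2 u hu
  | case5 c b a s hc =>
    rw [closeCycles, if_neg hc]
    simp_all

theorem rainflowScan_spec {P : ℝ → Prop} (l : List ℝ) : ∀ stack : List ℝ,
    (∀ u ∈ stack, P u) → (∀ u ∈ l, P u) → (∀ u ∈ (rainflowScan stack l).2, P u) ∧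
      ∀ u ∈ (rainflowScan stack l).1, ∃ a b, P a ∧ P b ∧ u = |a - b| := by
  induction l with
  | nil => intro stack h _; simpa [rainflowScan] using h
  | cons x l ih =>
    intro stack h hl
    obtain ⟨h1, h2⟩ := closeCycles_spec x (hl x (by simp)) stack h
    obtain ⟨h3, h4⟩ := ih _ h1 fun u hu => hl u (List.mem_cons_of_mem _ hu)
    rw [rainflowScan]
    refine ⟨h3, fun u hu => ?_⟩
    rcases List.mem_append.1 hu with hu | hu
    · exact h2 u hu
    · exact h4 u hu

theorem exists_of_mem_fullCycles {x : List ℝ} {u : ℝ} (h : u ∈ fullCycles x) :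
    ∃ a ∈ x, ∃ b ∈ x, u = |a - b| := by
  obtain ⟨a, b, ha, hb, hu⟩ := (rainflowScan_spec (P := (· ∈ x)) _ [] (by simp)
    (turningPoints_subset x)).2 u h
  exact ⟨a, ha, b, hb, hu⟩

theorem exists_of_mem_halfCycles {x : List ℝ} {u : ℝ} (h : u ∈ halfCycles x) :
    ∃ a ∈ x, ∃ b ∈ x, u = |a - b| := by
  have hr := (rainflowScan_spec (P := (· ∈ x)) _ [] (by simp) (turningPoints_subset x)).1
  change ∀ u ∈ residue x, u ∈ x at hr
  unfold halfCycles at h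
  generalize residue x = l at *
  induction l with
  | nil => simp at h
  | cons c l ih =>
    cases l with
    | nil => simp at h
    | cons d l =>
      rcases List.mem_cons.1 h with rfl | h
      · exact ⟨c, hr c (by simp), d, hr d (by simp), rfl⟩
      · exact ih h fun u hu => hr u (List.mem_cons_of_mem _ hu)

theorem cycle_nonneg {x : List ℝ} {u : ℝ} (h : u ∈ fullCycles x ∨ u ∈ halfCycles x) : 0 ≤ u := by
  rcases h with h | h
  · obtain ⟨a, -, b, -, rfl⟩ := exists_of_mem_fullCycles h; exact abs_nonneg _
  · obtain ⟨a, -, b, -, rfl⟩ := exists_of_mem_halfCycles h; exact abs_nonneg _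

theorem cycle_le {x : List ℝ} {u w : ℝ} (hx : ∀ a ∈ x, ∀ b ∈ x, a - b ≤ w)
    (h : u ∈ fullCycles x ∨ u ∈ halfCycles x) : u ≤ w := by
  rcases h with h | h
  · obtain ⟨a, ha, b, hb, rfl⟩ := exists_of_mem_fullCycles h
    exact abs_le'.2 ⟨hx a ha b hb, by linarith [hx b hb a ha]⟩
  · obtain ⟨a, ha, b, hb, rfl⟩ := exists_of_mem_halfCycles h
    exact abs_le'.2 ⟨hx a ha b hb, by linarith [hx b hb a ha]⟩

/-! ### Sums of concave functions of the depths -/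

/-- On a finite set of points, a concave increasing function vanishing at `0` is a combination of
the functions `min · s` with nonnegative coefficients. -/
theorem exists_eq_sum_min (F : Finset ℝ) : ∀ (f : ℝ → ℝ) (w : ℝ), 0 ≤ w →
    ConcaveOn ℝ (Set.Icc 0 w) f → MonotoneOn f (Set.Icc 0 w) → f 0 = 0 →
    (∀ u ∈ F, u ∈ Set.Icc 0 w) →
    ∃ L : List (ℝ × ℝ), (∀ q ∈ L, 0 ≤ q.1 ∧ q.2 ∈ Set.Icc 0 w) ∧
      ∀ u ∈ F, f u = (L.map fun q => q.1 * min u q.2).sum := by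
  induction F using Finset.induction_on_max with
  | empty => intro f w _ _ _ _ _; exact ⟨[], by simp, by simp⟩
  | insert t F hlt ih =>
    intro f w hw hc hm h0 hF
    have ht := hF t (by simp)
    -- the largest point below `t`, or `0` if there is none
    obtain ⟨t', ht'0, ht't, ht'max, ht'F⟩ : ∃ t', 0 ≤ t' ∧ t' ≤ t ∧ (∀ u ∈ F, u ≤ t') ∧
        (t' ∈ F ∨ t' = 0) := by
      rcases F.eq_empty_or_nonempty with rfl | hne
      · exact ⟨0, le_rfl, ht.1, by simp, .inr rfl⟩
      · exact ⟨F.max' hne, (hF _ (Finset.mem_insert_of_mem (F.max'_mem hne))).1,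
          (hlt _ (F.max'_mem hne)).le, fun u hu => F.le_max' u hu, .inl (F.max'_mem hne)⟩
    have ht'w : t' ∈ Set.Icc 0 w := ⟨ht'0, ht't.trans ht.2⟩
    set lam := (f t - f t') / (t - t') with hlam
    have hlam0 : 0 ≤ lam := div_nonneg (sub_nonneg.2 (hm ht'w ht ht't)) (by linarith)
    have hft : f t - f t' = lam * (t - t') := by
      rcases ht't.eq_or_lt with h | h
      · simp [h]
      · rw [hlam, div_mul_cancel₀ _ (by linarith)]
    have hsub : Set.Icc 0 t' ⊆ Set.Icc 0 w := Set.Icc_subset_Icc_right ht'w.2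
    have hslope : ∀ u ∈ Set.Icc 0 t', ∀ v ∈ Set.Icc 0 t', u ≤ v → lam * (v - u) ≤ f v - f u := by
      intro u hu v hv huv
      rcases huv.eq_or_lt with rfl | huv
      · simp
      rcases ht't.eq_or_lt with h | h
      · have : lam = 0 := by rw [hlam, h]; simp
        rw [this, zero_mul]
        exact sub_nonneg.2 (hm (hsub hu) (hsub hv) huv.le)
      have h1 : lam ≤ (f v - f u) / (v - u) := by
        rcases hv.2.eq_or_lt with rfl | hvt
        · exact hc.slope_anti_adjacent (hsub hu) ht huv h
        · exact (hc.slope_anti_adjacent (hsub hv) ht hvt h).trans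
            (hc.slope_anti_adjacent (hsub hu) ht'w huv hvt)
      rwa [le_div_iff₀ (by linarith)] at h1
    obtain ⟨L, hL, hLF⟩ := ih (fun u => f u - lam * u) t' ht'0
      (by
        have h1 := hc.subset hsub (convex_Icc 0 t')
        have h2 : ConvexOn ℝ (Set.Icc 0 t') fun u : ℝ => lam * u :=
          ((LinearMap.mul ℝ ℝ lam).convexOn (convex_Icc 0 t'))
        exact h1.sub h2)
      (fun u hu v hv huv => by have := hslope u hu v hv huv; simp only; linarith)
      (by simp [h0]) (fun u hu => ⟨(hF u (Finset.mem_insert_of_mem hu)).1, ht'max u hu⟩)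
    refine ⟨(lam, t) :: L, ?_, fun u hu => ?_⟩
    · intro q hq
      rcases List.mem_cons.1 hq with rfl | hq
      · exact ⟨hlam0, ht⟩
      · exact ⟨(hL q hq).1, hsub (hL q hq).2⟩
    · rw [List.map_cons, List.sum_cons]
      rcases Finset.mem_insert.1 hu with rfl | hu
      · have h1 : (L.map fun q => q.1 * min u q.2).sum = f t' - lam * t' := by
          have h2 : (L.map fun q => q.1 * min u q.2) = L.map fun q => q.1 * min t' q.2 :=
            List.map_congr_left fun q hq => by
              rw [min_eq_right ((hL q hq).2.2.trans ht't), min_eq_right (hL q hq).2.2]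
          rw [h2]
          rcases ht'F with h | h
          · exact (hLF t' h).symm
          · have h3 : (L.map fun q => q.1 * min t' q.2) = L.map fun _ => 0 :=
              List.map_congr_left fun q hq => by rw [h, min_eq_left (hL q hq).2.1, mul_zero]
            rw [h3, h, h0]; simp
        rw [h1, min_self]; linarith
      · rw [← hLF u hu, min_eq_left (hlt u hu).le]; ring

theorem rainflowSum_congr {f g : ℝ → ℝ} {x : List ℝ}
    (h : ∀ u, u ∈ fullCycles x ∨ u ∈ halfCycles x → f u = g u) :
    rainflowSum f x = rainflowSum g x := by
  rw [rainflowSum, rainflowSum, List.map_congr_left fun u hu => h u (.inl hu),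
    List.map_congr_left fun u hu => h u (.inr hu)]

theorem rainflowSum_add (f g : ℝ → ℝ) (x : List ℝ) :
    rainflowSum (fun u => f u + g u) x = rainflowSum f x + rainflowSum g x := by
  simp only [rainflowSum, List.sum_map_add]; ring

theorem rainflowSum_const_mul (c : ℝ) (f : ℝ → ℝ) (x : List ℝ) :
    rainflowSum (fun u => c * f u) x = c * rainflowSum f x := by
  simp only [rainflowSum, List.sum_map_mul_left]; ring

theorem rainflowSum_sum_min (L : List (ℝ × ℝ)) (x : List ℝ) :
    rainflowSum (fun u => (L.map fun q => q.1 * min u q.2).sum) x =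
      (L.map fun q => q.1 * rainflowSum (min · q.2) x).sum := by
  induction L with
  | nil => simp [rainflowSum]
  | cons q L ih =>
    simp only [List.map_cons, List.sum_cons]
    rw [rainflowSum_add, ih, rainflowSum_const_mul]

/-- An inequality between the capped depth sums for all caps up to `w` carries over to concave
increasing functions of the depths capped at `w`. -/
theorem rainflowSum_concave_le {f : ℝ → ℝ} {w a : ℝ} (hw : 0 ≤ w)
    (hc : ConcaveOn ℝ (Set.Icc 0 w) f) (hm : MonotoneOn f (Set.Icc 0 w)) (h0 : f 0 = 0)
    {x y : List ℝ} (hy : ∀ u, u ∈ fullCycles y ∨ u ∈ halfCycles y → u ≤ w) (ha : a ∈ Set.Icc 0 w)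
    (h : ∀ s ∈ Set.Icc 0 w,
      rainflowSum (min · s) x + 2 * (s - min a s) ≤ rainflowSum (min · s) y) :
    rainflowSum (fun u => f (min u w)) x + 2 * (f w - f a) ≤ rainflowSum f y := by
  classical
  obtain ⟨L, hL, hLF⟩ := exists_eq_sum_min
    (((fullCycles x ++ halfCycles x).map (min · w) ++ (fullCycles y ++ halfCycles y) ++
      [w, a]).toFinset) f w hw hc hm h0 (by
        intro u hu
        simp only [List.mem_toFinset, List.mem_append, List.mem_map, List.mem_cons,
          List.not_mem_nil, or_false] at hu
        rcases hu with (⟨v, hv, rfl⟩ | hu) | rfl | rfl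
        · exact ⟨le_min (cycle_nonneg hv) hw, min_le_right _ _⟩
        · exact ⟨cycle_nonneg hu, hy u hu⟩
        · exact ⟨hw, le_rfl⟩
        · exact ha)
  simp only [List.mem_toFinset, List.mem_append, List.mem_map, List.mem_cons, List.not_mem_nil,
    or_false] at hLF
  have hx' : rainflowSum (fun u => f (min u w)) x =
      (L.map fun q => q.1 * rainflowSum (min · q.2) x).sum := by
    rw [← rainflowSum_sum_min]
    refine rainflowSum_congr fun u hu => ?_
    rw [hLF _ (.inl (.inl ⟨u, hu, rfl⟩))]
    refine congrArg _ (List.map_congr_left fun q hq => ?_)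
    rw [min_assoc, min_eq_right (hL q hq).2.2]
  have hy' : rainflowSum f y = (L.map fun q => q.1 * rainflowSum (min · q.2) y).sum := by
    rw [← rainflowSum_sum_min]
    exact rainflowSum_congr fun u hu => hLF _ (.inl (.inr hu))
  rw [hx', hy', hLF w (.inr (.inl rfl)), hLF a (.inr (.inr rfl))]
  clear hLF hx' hy'
  induction L with
  | nil => simp
  | cons q L ih =>
    have := ih fun q hq => hL q (List.mem_cons_of_mem _ hq)
    obtain ⟨h1, h2⟩ := hL q (by simp)
    have h3 := mul_le_mul_of_nonneg_left (h q.2 h2) h1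
    simp only [List.map_cons, List.sum_cons]
    rw [min_eq_right h2.2]
    linarith

theorem sum_map_nonpos {f : ℝ → ℝ} {l : List ℝ} (hf : ∀ u ∈ l, f u ≤ 0) : (l.map f).sum ≤ 0 := by
  induction l with
  | nil => simp
  | cons u l ih =>
    rw [List.map_cons, List.sum_cons]
    exact add_nonpos (hf u (by simp)) (ih fun v hv => hf v (List.mem_cons_of_mem _ hv))

theorem sum_map_le_of_mem {f : ℝ → ℝ} {l : List ℝ} (hf : ∀ u ∈ l, f u ≤ 0) {v : ℝ} (hv : v ∈ l) :
    (l.map f).sum ≤ f v := by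
  rw [((List.perm_cons_erase hv).map f).sum_eq, List.map_cons, List.sum_cons]
  have : ((l.erase v).map f).sum ≤ 0 := by
    exact sum_map_nonpos fun u hu => hf u (List.mem_of_mem_erase hu)
  linarith

/-- Capping all depths at the maximizer `w` of `f` gains at least the loss of the deepest half
cycle. -/
theorem rainflowSum_le_cap {f : ℝ → ℝ} {w : ℝ} (hmax : ∀ u, 0 ≤ u → f u ≤ f w) (x : List ℝ) :
    ∃ H, (∀ u ∈ halfCycles x, u ≤ H) ∧
      rainflowSum f x ≤ rainflowSum (fun u => f (min u w)) x + (f (w + max (H - w) 0) - f w) := by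
  have hle : ∀ u, u ∈ fullCycles x ∨ u ∈ halfCycles x → f u - f (min u w) ≤ 0 := by
    intro u hu
    rcases le_total u w with h | h
    · simp [min_eq_left h]
    · rw [min_eq_right h]; linarith [hmax u (cycle_nonneg hu)]
  have hsplit : rainflowSum f x = rainflowSum (fun u => f (min u w)) x +
      rainflowSum (fun u => f u - f (min u w)) x := by
    rw [← rainflowSum_add]; congr 1; funext u; ring
  have hdef : rainflowSum (fun u => f u - f (min u w)) x =
      2 * ((fullCycles x).map fun u => f u - f (min u w)).sum +
        ((halfCycles x).map fun u => f u - f (min u w)).sum := rfl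
  rw [hdef] at hsplit
  have hfull : ((fullCycles x).map fun u => f u - f (min u w)).sum ≤ 0 := by
    exact sum_map_nonpos fun u hu => hle u (.inl hu)
  by_cases hex : ∃ u ∈ halfCycles x, w < u
  · obtain ⟨u, hu, huw⟩ := hex
    classical
    obtain ⟨H, hH, hHmax⟩ := (halfCycles x).toFinset.exists_max_image id ⟨u, by simpa using hu⟩
    simp only [List.mem_toFinset, id] at hH hHmax
    refine ⟨H, hHmax, ?_⟩
    have hHw : w < H := huw.trans_le (hHmax u hu)
    rw [hsplit, max_eq_left (by linarith)]
    have := sum_map_le_of_mem (fun u hu => hle u (.inr hu)) hH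
    simp only [min_eq_right hHw.le] at this
    rw [add_sub_cancel]
    linarith
  · refine ⟨w, fun u hu => not_lt.1 fun h => hex ⟨u, hu, h⟩, ?_⟩
    have : ((halfCycles x).map fun u => f u - f (min u w)).sum ≤ 0 := by
      exact sum_map_nonpos fun u hu => hle u (.inr hu)
    rw [hsplit]
    simp only [sub_self, max_self, add_zero]
    linarith

theorem rainflowSum_min_zero (x : List ℝ) : rainflowSum (min · 0) x = 0 := by
  rw [rainflowSum_congr (g := fun _ => 0) fun u hu => min_eq_right (cycle_nonneg hu)]
  simp [rainflowSum]

section Dominated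

variable {w : ℝ} {T : ℕ} {x y : ℕ → ℝ} {f : ℝ → ℝ}

theorem Dominated.cycle_le (h : Dominated w T x y) {u : ℝ}
    (hu : u ∈ fullCycles ((List.range (T + 1)).map y) ∨
      u ∈ halfCycles ((List.range (T + 1)).map y)) : u ≤ w := by
  refine _root_.cycle_le (fun a ha b hb => ?_) hu
  obtain ⟨i, hi, rfl⟩ := List.mem_map.1 ha
  obtain ⟨j, hj, rfl⟩ := List.mem_map.1 hb
  exact h.range_le i (by simpa [Nat.lt_succ_iff] using hi) j (by simpa [Nat.lt_succ_iff] using hj)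

/-- The dominating path collects the larger sum of `f` over its cycles when `f` is concave and
maximal at `w`. -/
theorem Dominated.rainflowSum_le (h : Dominated w T x y) (hw : 0 ≤ w)
    (hc : ConcaveOn ℝ (Set.Icc 0 w) f) (hm : MonotoneOn f (Set.Icc 0 w)) (h0 : f 0 = 0)
    (hmax : ∀ u, 0 ≤ u → f u ≤ f w) :
    rainflowSum f ((List.range (T + 1)).map x) ≤ rainflowSum f ((List.range (T + 1)).map y) := by
  obtain ⟨H, -, h2⟩ := rainflowSum_le_cap hmax ((List.range (T + 1)).map x)
  have h3 := hmax (w + max (H - w) 0) (by positivity)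
  have h4 := rainflowSum_concave_le hw hc hm h0 (a := w) (fun u hu => h.cycle_le hu)
    ⟨hw, le_rfl⟩ (x := (List.range (T + 1)).map x) (fun s hs => by
      rw [min_eq_right hs.2]
      simpa using (h.rainflowSum_min_le hs.1 hs.2).1)
  linarith

/-- When upward movement is worth `k` more and downward movement `k` less than in the definition of
`f`, the dominated path can profit from a higher final level. The gain is bounded by that of one
upward half cycle and two downward half cycles of optimal depth over such cycles of depth `w`. -/
theorem Dominated.rainflowSum_add_le (h : Dominated w T x y) (hw : 0 ≤ w)
    (hc : ConcaveOn ℝ (Set.Icc 0 w) f) (hm : MonotoneOn f (Set.Icc 0 w)) (h0 : f 0 = 0)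
    (hmax : ∀ u, 0 ≤ u → f u ≤ f w) {k a b : ℝ} (hk : 0 ≤ k)
    (ha : ∀ u, 0 ≤ u → f u + k * u ≤ a) (hb : ∀ u, 0 ≤ u → f u - k * u ≤ b) :
    rainflowSum f ((List.range (T + 1)).map x) + k * (x T - y T) ≤
      rainflowSum f ((List.range (T + 1)).map y) +
        (2 * (b - (f w - k * w)) + (a - (f w + k * w))) := by
  obtain ⟨H, hH, h2⟩ := rainflowSum_le_cap hmax ((List.range (T + 1)).map x)
  set ρ := max (H - w) 0 with hρ
  have hρ0 : 0 ≤ ρ := le_max_right _ _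
  have h3 := ha (w + ρ) (by positivity)
  rcases le_total (x T - y T - ρ) 0 with hθ | hθ
  · have h4 := rainflowSum_concave_le hw hc hm h0 (a := w) (fun u hu => h.cycle_le hu)
      ⟨hw, le_rfl⟩ (x := (List.range (T + 1)).map x) (fun s hs => by
        rw [min_eq_right hs.2]
        simpa using (h.rainflowSum_min_le hs.1 hs.2).1)
    have h5 := hb w hw
    have h6 := mul_nonneg hk (neg_nonneg.2 hθ)
    linarith
  · have h4 := (h.rainflowSum_min_le le_rfl hw).2 H hH
    rw [rainflowSum_min_zero, rainflowSum_min_zero] at h4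
    -- the cap above which the comparison of the final levels is the stronger one
    obtain ⟨c, hcdef⟩ : ∃ c, c = w - (x T - y T - ρ) / 2 := ⟨_, rfl⟩
    have hc0 : 0 ≤ c := by linarith
    have hcw : c ≤ w := by linarith
    have h5 := rainflowSum_concave_le hw hc hm h0 (a := c) (fun u hu => h.cycle_le hu)
      ⟨hc0, hcw⟩ (x := (List.range (T + 1)).map x) (fun s hs => by
        obtain ⟨h6, h7⟩ := h.rainflowSum_min_le hs.1 hs.2
        rcases le_total c s with h8 | h8
        · rw [min_eq_left h8]
          have := h7 H hH
          linarith
        · rw [min_eq_right h8]; linarith)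
    have h6 := hb c hc0
    have h7 : k * (x T - y T) = 2 * (k * (w - c)) + k * ρ := by rw [hcdef]; ring
    linarith

end Dominated

namespace Battery

variable (S : Battery)

/-! ### The energy levels under the threshold policy -/

theorem nextEnergy_of_nonneg {e b : ℝ} (hb : 0 ≤ b) : S.nextEnergy e b = e + S.M * S.η * b := by
  rw [nextEnergy, max_eq_left hb, max_eq_right (by linarith)]; simp

theorem nextEnergy_of_nonpos {e b : ℝ} (hb : b ≤ 0) : S.nextEnergy e b = e + S.M * b / S.η := by
  rw [nextEnergy, max_eq_right hb, max_eq_left (by linarith)]; ring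

/-- The invariant of the policy: the remembered levels are ordered, within the energy limits, and
span a range of at most `u * S.E`. -/
structure PolicyState.Valid (u : ℝ) (s : PolicyState) : Prop where
  le_emax : s.e ≤ s.emax
  emin_le : s.emin ≤ s.e
  range_le : s.emax - s.emin ≤ u * S.E
  Elo_le : S.Elo ≤ s.e
  le_Ehi : s.e ≤ S.Ehi

variable {S} {u e₀ C : ℝ} {s : PolicyState}

theorem policyDispatch_of_nonneg (hs : PolicyState.Valid S u s) {p : ℝ} (hp : 0 ≤ p) :
    0 ≤ S.policyDispatch u s p ∧ S.policyDispatch u s p ≤ p ∧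
    S.nextEnergy s.e (S.policyDispatch u s p) =
      min (min S.Ehi (s.emin + u * S.E)) (s.e + S.M * S.η * p) := by
  have hM₀ := S.M_pos
  have hη₀ := S.η_pos
  have hM : 0 < S.M * S.η := mul_pos hM₀ hη₀
  have hG : s.e ≤ min S.Ehi (s.emin + u * S.E) :=
    le_min hs.le_Ehi (by linarith [hs.range_le, hs.le_emax])
  have h0 : 0 ≤ S.policyDispatch u s p := by
    rw [policyDispatch, if_pos hp]
    exact le_min (mul_nonneg (by positivity) (by linarith)) hp
  refine ⟨h0, ?_, ?_⟩
  · rw [policyDispatch, if_pos hp]; exact min_le_right _ _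
  · rw [nextEnergy_of_nonneg S h0, policyDispatch, if_pos hp, mul_min_of_nonneg _ _ hM.le,
      ← min_add_add_left]
    congr 1
    field_simp; ring

theorem policyDispatch_of_neg (hs : PolicyState.Valid S u s) {p : ℝ} (hp : p < 0) :
    S.policyDispatch u s p ≤ 0 ∧ p ≤ S.policyDispatch u s p ∧
    S.nextEnergy s.e (S.policyDispatch u s p) =
      max (max S.Elo (s.emax - u * S.E)) (s.e + S.M * p / S.η) := by
  have hM := S.M_pos
  have hη := S.η_pos
  have hM' : 0 < S.M / S.η := by positivity
  have hG : max S.Elo (s.emax - u * S.E) ≤ s.e :=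
    max_le hs.Elo_le (by linarith [hs.range_le, hs.emin_le])
  have h0 : S.policyDispatch u s p ≤ 0 := by
    rw [policyDispatch, if_neg (not_le.2 hp)]
    exact max_le (mul_nonpos_of_nonneg_of_nonpos (by positivity) (by linarith)) hp.le
  refine ⟨h0, ?_, ?_⟩
  · rw [policyDispatch, if_neg (not_le.2 hp)]; exact le_max_right _ _
  · rw [nextEnergy_of_nonpos S h0, policyDispatch, if_neg (not_le.2 hp), mul_div_right_comm,
      mul_max_of_nonneg _ _ hM'.le, ← max_add_add_left]
    congr 1
    · field_simp; ring
    · ring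

theorem PolicyState.Valid.policyStep (hs : PolicyState.Valid S u s) (p : ℝ) :
    PolicyState.Valid S u (S.policyStep u s p) := by
  rcases le_or_gt 0 p with hp | hp
  · obtain ⟨h1, -, h3⟩ := policyDispatch_of_nonneg hs hp
    have h4 : s.e ≤ S.nextEnergy s.e (S.policyDispatch u s p) := by
      rw [nextEnergy_of_nonneg S h1]
      have := mul_nonneg (mul_pos S.M_pos S.η_pos).le h1
      linarith
    have h5 : S.nextEnergy s.e (S.policyDispatch u s p) ≤ min S.Ehi (s.emin + u * S.E) := by
      rw [h3]; exact min_le_left _ _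
    have h6 := le_min_iff.1 h5
    refine ⟨le_max_right _ _, min_le_right _ _, ?_, hs.Elo_le.trans h4, h6.1⟩
    simp only [Battery.policyStep]
    rw [min_eq_left (hs.emin_le.trans h4), sub_le_iff_le_add]
    exact max_le (by linarith [hs.range_le]) (by linarith)
  · obtain ⟨h1, -, h3⟩ := policyDispatch_of_neg hs hp
    have h4 : S.nextEnergy s.e (S.policyDispatch u s p) ≤ s.e := by
      rw [nextEnergy_of_nonpos S h1]
      have := div_nonneg (mul_nonneg S.M_pos.le (neg_nonneg.2 h1)) S.η_pos.le
      rw [mul_neg, neg_div] at this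
      linarith
    have h5 : max S.Elo (s.emax - u * S.E) ≤ S.nextEnergy s.e (S.policyDispatch u s p) := by
      rw [h3]; exact le_max_left _ _
    have h6 := max_le_iff.1 h5
    refine ⟨le_max_right _ _, min_le_right _ _, ?_, h6.1, h4.trans hs.le_Ehi⟩
    simp only [Battery.policyStep]
    rw [max_eq_left (h4.trans hs.le_emax), sub_le_comm]
    exact le_min (by linarith [hs.range_le]) (by linarith)

variable {r : ℕ → ℝ}

theorem energy_policy (t : ℕ) :
    S.energy e₀ (S.policy u e₀ C r) t = (S.policyState u e₀ C r t).e := by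
  induction t with
  | zero => rfl
  | succ t ih => rw [energy, ih]; rfl

theorem valid_policyState (hu : 0 ≤ u) (he : e₀ ∈ Set.Icc S.Elo S.Ehi) (t : ℕ) :
    PolicyState.Valid S u (S.policyState u e₀ C r t) := by
  induction t with
  | zero =>
    refine ⟨le_rfl, le_rfl, ?_, he.1, he.2⟩
    simpa [policyState] using mul_nonneg hu S.E_pos.le
  | succ t ih => exact ih.policyStep _

theorem energy_le_emax (t : ℕ) : ∀ i ≤ t,
    S.energy e₀ (S.policy u e₀ C r) i ≤ (S.policyState u e₀ C r t).emax := by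
  induction t with
  | zero => intro i hi; obtain rfl : i = 0 := by omega
            exact le_rfl
  | succ t ih =>
    intro i hi
    rcases hi.lt_or_eq with hi | rfl
    · exact (ih i (by omega)).trans (le_max_left _ _)
    · rw [energy_policy]; exact le_max_right _ _

theorem emin_le_energy (t : ℕ) : ∀ i ≤ t,
    (S.policyState u e₀ C r t).emin ≤ S.energy e₀ (S.policy u e₀ C r) i := by
  induction t with
  | zero => intro i hi; obtain rfl : i = 0 := by omega
            exact le_rfl
  | succ t ih =>
    intro i hi
    rcases hi.lt_or_eq with hi | rfl
    · exact (min_le_left _ _).trans (ih i (by omega))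
    · rw [energy_policy]; exact min_le_right _ _

theorem exists_energy_eq_emax (t : ℕ) : ∃ j ≤ t,
    S.energy e₀ (S.policy u e₀ C r) j = (S.policyState u e₀ C r t).emax := by
  induction t with
  | zero => exact ⟨0, le_rfl, rfl⟩
  | succ t ih =>
    obtain ⟨j, hj, h⟩ := ih
    have h' : (S.policyState u e₀ C r (t + 1)).emax =
      max (S.policyState u e₀ C r t).emax (S.policyState u e₀ C r (t + 1)).e := rfl
    rcases le_total (S.policyState u e₀ C r t).emax (S.policyState u e₀ C r (t + 1)).e with hc | hc
    · exact ⟨t + 1, le_rfl, by rw [h', max_eq_right hc, energy_policy]⟩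
    · exact ⟨j, by omega, by rw [h', max_eq_left hc, h]⟩

theorem exists_energy_eq_emin (t : ℕ) : ∃ j ≤ t,
    S.energy e₀ (S.policy u e₀ C r) j = (S.policyState u e₀ C r t).emin := by
  induction t with
  | zero => exact ⟨0, le_rfl, rfl⟩
  | succ t ih =>
    obtain ⟨j, hj, h⟩ := ih
    have h' : (S.policyState u e₀ C r (t + 1)).emin =
      min (S.policyState u e₀ C r t).emin (S.policyState u e₀ C r (t + 1)).e := rfl
    rcases le_total (S.policyState u e₀ C r t).emin (S.policyState u e₀ C r (t + 1)).e with hc | hc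
    · exact ⟨j, by omega, by rw [h', min_eq_left hc, h]⟩
    · exact ⟨t + 1, le_rfl, by rw [h', min_eq_right hc, energy_policy]⟩

theorem energy_policy_sub_le (hu : 0 ≤ u) (he : e₀ ∈ Set.Icc S.Elo S.Ehi) (i j : ℕ) :
    S.energy e₀ (S.policy u e₀ C r) i - S.energy e₀ (S.policy u e₀ C r) j ≤ u * S.E := by
  have h1 := energy_le_emax (S := S) (u := u) (e₀ := e₀) (C := C) (r := r) (max i j) i
    (le_max_left _ _)
  have h2 := emin_le_energy (S := S) (u := u) (e₀ := e₀) (C := C) (r := r) (max i j) j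
    (le_max_right _ _)
  have h3 := (valid_policyState (C := C) (r := r) hu he (max i j)).range_le
  linarith

theorem admissible_policy (hu : 0 ≤ u) (he : e₀ ∈ Set.Icc S.Elo S.Ehi) (hC : C ∈ Set.Icc 0 S.B)
    {T : ℕ} (hr : ∀ t < T, r t ∈ Set.Icc (-1 : ℝ) 1) :
    S.Admissible e₀ C r T (S.policy u e₀ C r) := by
  have hV := valid_policyState (C := C) (r := r) hu he
  have hB := S.B_nonneg
  -- the response has the sign of the instruction and does not exceed it
  have key : ∀ t, (0 ≤ S.policy u e₀ C r t ∧ S.policy u e₀ C r t ≤ C * r t) ∨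
      (S.policy u e₀ C r t ≤ 0 ∧ C * r t ≤ S.policy u e₀ C r t) := by
    intro t
    rcases le_or_gt 0 (C * r t) with h | h
    · exact .inl ⟨(policyDispatch_of_nonneg (hV t) h).1, (policyDispatch_of_nonneg (hV t) h).2.1⟩
    · exact .inr ⟨(policyDispatch_of_neg (hV t) h).1, (policyDispatch_of_neg (hV t) h).2.1⟩
  refine ⟨fun t ht => ?_, fun t _ => ?_, fun t _ => ?_, fun t _ => ?_⟩
  · have h1 : C * r t ≤ S.B := (mul_le_of_le_one_right hC.1 (hr t ht).2).trans hC.2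
    have h2 : -S.B ≤ C * r t := by nlinarith [mul_nonneg hC.1 (sub_nonneg.2 (hr t ht).1), hC.2]
    rcases key t with h | h <;> constructor <;> linarith
  · rw [energy_policy]; exact ⟨(hV t).Elo_le, (hV t).le_Ehi⟩
  · have h0 : 0 ≤ C * max (r t) 0 := mul_nonneg hC.1 (le_max_right _ _)
    have h1 : C * r t ≤ C * max (r t) 0 := mul_le_mul_of_nonneg_left (le_max_left _ _) hC.1
    rcases key t with h | h <;> exact max_le (by linarith) h0
  · have h0 : 0 ≤ C * max (-r t) 0 := mul_nonneg hC.1 (le_max_right _ _)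
    have h1 : C * -r t ≤ C * max (-r t) 0 := mul_le_mul_of_nonneg_left (le_max_left _ _) hC.1
    rcases key t with h | h <;> exact max_le (by linarith) h0

/-! ### The policy dominates every admissible response -/

theorem Admissible.bounds {T : ℕ} {b : ℕ → ℝ} (hb : S.Admissible e₀ C r T b) (hC : 0 ≤ C) {t : ℕ}
    (ht : t < T) : (0 ≤ C * r t → 0 ≤ b t ∧ b t ≤ C * r t) ∧
      (C * r t ≤ 0 → b t ≤ 0 ∧ C * r t ≤ b t) := by
  have h1 := hb.charge t ht
  have h2 := hb.discharge t ht
  rw [mul_max_of_nonneg _ _ hC, mul_zero] at h1 h2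
  have h3 := max_le_iff.1 h1
  have h4 := max_le_iff.1 h2
  constructor <;> intro h
  · rw [max_eq_left h] at h3
    rw [max_eq_right (by linarith)] at h4
    exact ⟨by linarith, h3.1⟩
  · rw [max_eq_right h] at h3
    rw [max_eq_left (by linarith)] at h4
    exact ⟨h3.1, by linarith⟩

theorem dominated_policy (hu : 0 ≤ u) (he : e₀ ∈ Set.Icc S.Elo S.Ehi) (hC : 0 ≤ C)
    {T : ℕ} {b : ℕ → ℝ} (hb : S.Admissible e₀ C r T b) :
    Dominated u T (fun t => S.energy e₀ b t / S.E)
      (fun t => S.energy e₀ (S.policy u e₀ C r) t / S.E) := by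
  have hE := S.E_pos
  have hMη : 0 < S.M * S.η := mul_pos S.M_pos S.η_pos
  have hrange : ∀ i j, S.energy e₀ (S.policy u e₀ C r) i / S.E -
      S.energy e₀ (S.policy u e₀ C r) j / S.E ≤ u := by
    intro i j
    rw [← sub_div, div_le_iff₀ hE]
    exact energy_policy_sub_le hu he i j
  refine ⟨rfl, fun i _ j _ => hrange i j, fun t ht => ?_⟩
  have hV := valid_policyState (C := C) (r := r) hu he t
  have hV' : ∀ i, S.Elo ≤ S.energy e₀ (S.policy u e₀ C r) i ∧
      S.energy e₀ (S.policy u e₀ C r) i ≤ S.Ehi := fun i => by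
    have := valid_policyState (C := C) (r := r) hu he i
    rw [energy_policy]; exact ⟨this.Elo_le, this.le_Ehi⟩
  have hy : S.energy e₀ (S.policy u e₀ C r) (t + 1) = S.nextEnergy (S.policyState u e₀ C r t).e
      (S.policyDispatch u (S.policyState u e₀ C r t) (C * r t)) := by
    rw [energy, energy_policy]; rfl
  have hx : S.energy e₀ b (t + 1) = S.nextEnergy (S.energy e₀ b t) (b t) := rfl
  have hyt := energy_policy (S := S) (u := u) (e₀ := e₀) (C := C) (r := r) t
  have hxm := hb.energy_mem (t + 1) ht
  rcases le_or_gt 0 (C * r t) with hp | hp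
  · left
    obtain ⟨hb0, hb1⟩ := (hb.bounds hC ht).1 hp
    obtain ⟨h1, h2, h3⟩ := policyDispatch_of_nonneg hV hp
    rw [nextEnergy_of_nonneg S hb0] at hx
    rw [h3] at hy
    have hup : (S.policyState u e₀ C r t).e ≤ S.energy e₀ (S.policy u e₀ C r) (t + 1) := by
      rw [hy]
      refine le_min (le_min hV.le_Ehi (by linarith [hV.range_le, hV.le_emax])) ?_
      have := mul_nonneg hMη.le hp
      linarith
    refine ⟨?_, ?_, ?_⟩
    · have := mul_nonneg hMη.le hb0
      exact div_le_div_of_nonneg_right (by linarith) hE.le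
    · exact div_le_div_of_nonneg_right (by linarith) hE.le
    rcases min_choice (min S.Ehi ((S.policyState u e₀ C r t).emin + u * S.E))
      ((S.policyState u e₀ C r t).e + S.M * S.η * (C * r t)) with hm | hm
    · right
      rw [hm] at hy
      rcases min_choice S.Ehi ((S.policyState u e₀ C r t).emin + u * S.E) with hm | hm
      · rw [hm] at hy
        refine ⟨fun i _ => ?_, .inl ?_⟩
        · exact div_le_div_of_nonneg_right (by linarith [(hV' i).2]) hE.le
        · exact div_le_div_of_nonneg_right (by linarith [hxm.2]) hE.le
      · rw [hm] at hy
        obtain ⟨j, hj, hej⟩ :=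
          exists_energy_eq_emin (S := S) (u := u) (e₀ := e₀) (C := C) (r := r) t
        have hju : S.energy e₀ (S.policy u e₀ C r) j / S.E + u =
            S.energy e₀ (S.policy u e₀ C r) (t + 1) / S.E := by
          rw [hy, hej]; field_simp
        exact ⟨fun i _ => by have := hrange i j; linarith, .inr ⟨j, hj, hju.le⟩⟩
    · left
      rw [hm] at hy
      rw [← sub_div, ← sub_div]
      have := mul_le_mul_of_nonneg_left hb1 hMη.le
      exact div_le_div_of_nonneg_right (by linarith) hE.le
  · right
    obtain ⟨hb0, hb1⟩ := (hb.bounds hC ht).2 hp.le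
    obtain ⟨h1, h2, h3⟩ := policyDispatch_of_neg hV hp
    rw [nextEnergy_of_nonpos S hb0] at hx
    rw [h3] at hy
    have hneg : ∀ {c : ℝ}, c ≤ 0 → S.M * c / S.η ≤ 0 := fun hc =>
      div_nonpos_of_nonpos_of_nonneg (mul_nonpos_of_nonneg_of_nonpos S.M_pos.le hc) S.η_pos.le
    have hdn : S.energy e₀ (S.policy u e₀ C r) (t + 1) ≤ (S.policyState u e₀ C r t).e := by
      rw [hy]
      refine max_le (max_le hV.Elo_le (by linarith [hV.range_le, hV.emin_le])) ?_
      linarith [hneg hp.le]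
    refine ⟨?_, ?_, ?_⟩
    · exact neg_le_neg (div_le_div_of_nonneg_right (by linarith [hneg hb0]) hE.le)
    · exact neg_le_neg (div_le_div_of_nonneg_right (by linarith) hE.le)
    simp only [Pi.neg_apply, neg_le_neg_iff]
    rcases max_choice (max S.Elo ((S.policyState u e₀ C r t).emax - u * S.E))
      ((S.policyState u e₀ C r t).e + S.M * (C * r t) / S.η) with hm | hm
    · right
      rw [hm] at hy
      rcases max_choice S.Elo ((S.policyState u e₀ C r t).emax - u * S.E) with hm | hm
      · rw [hm] at hy
        refine ⟨fun i _ => ?_, .inl ?_⟩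
        · exact div_le_div_of_nonneg_right (by linarith [(hV' i).1]) hE.le
        · exact div_le_div_of_nonneg_right (by linarith [hxm.1]) hE.le
      · rw [hm] at hy
        obtain ⟨j, hj, hej⟩ :=
          exists_energy_eq_emax (S := S) (u := u) (e₀ := e₀) (C := C) (r := r) t
        have hju : S.energy e₀ (S.policy u e₀ C r) j / S.E - u =
            S.energy e₀ (S.policy u e₀ C r) (t + 1) / S.E := by
          rw [hy, hej]; field_simp
        exact ⟨fun i _ => by have := hrange j i; linarith, .inr ⟨j, hj, by linarith⟩⟩
    · left
      rw [hm] at hy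
      rw [neg_sub_neg, neg_sub_neg, ← sub_div, ← sub_div]
      have := div_le_div_of_nonneg_right (mul_le_mul_of_nonneg_left hb1 S.M_pos.le) S.η_pos.le
      exact div_le_div_of_nonneg_right (by linarith) hE.le

/-! ### The cost in terms of the rainflow cycles -/

/-- For an admissible response the mismatch penalty is that of the zero response minus a reward for
the energy moved. Up to the factor `S.E * S.R / 2`, a move of unit depth is rewarded by the
coefficient of `v` below, plus the coefficient of the final level if it is upward and minus the
latter if it is downward. -/
theorem cost_eq (Φ : ℝ → ℝ) {κ p : ℝ} (hκ : κ = p * S.M) (hC : 0 ≤ C) {T : ℕ} {b : ℕ → ℝ}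
    (hb : S.Admissible e₀ C r T b) :
    S.cost Φ κ e₀ C r T b = κ * (∑ t ∈ Finset.range T, |C * r t|) - S.E * S.R / 2 *
      (rainflowSum (fun v => (S.η ^ 2 + 1) / (S.η * S.R) * p * v - Φ v) (S.socProfile e₀ b T) +
        p * (1 / S.η - S.η) / S.R * (S.energy e₀ b T / S.E - e₀ / S.E)) := by
  have hE := S.E_pos
  have hR := S.R_pos
  have hη := S.η_pos
  have hM := S.M_pos
  set c := (S.η ^ 2 + 1) / (S.η * S.R) * p with hc
  set k := p * (1 / S.η - S.η) / S.R with hk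
  have hsum : rainflowSum (fun v => c * v - Φ v) (S.socProfile e₀ b T) =
      c * rainflowSum (fun v => v) (S.socProfile e₀ b T) - rainflowSum Φ (S.socProfile e₀ b T) := by
    rw [← rainflowSum_const_mul, eq_sub_iff_add_eq, ← rainflowSum_add]
    congr 1; funext v; ring
  have htv : rainflowSum (fun v => v) (S.socProfile e₀ b T) = ∑ t ∈ Finset.range T,
      |S.energy e₀ b (t + 1) / S.E - S.energy e₀ b t / S.E| := by
    rw [← sum_ranges_eq_rainflowSum, socProfile, ranges_map_range]
  have htel : S.energy e₀ b T / S.E - e₀ / S.E = ∑ t ∈ Finset.range T,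
      (S.energy e₀ b (t + 1) / S.E - S.energy e₀ b t / S.E) :=
    (Finset.sum_range_sub (fun t => S.energy e₀ b t / S.E) T).symm
  have hstep : κ * (∑ t ∈ Finset.range T, |C * r t - b t|) =
      κ * (∑ t ∈ Finset.range T, |C * r t|) - S.E * S.R / 2 * (c * (∑ t ∈ Finset.range T,
        |S.energy e₀ b (t + 1) / S.E - S.energy e₀ b t / S.E|) + k * (∑ t ∈ Finset.range T,
        (S.energy e₀ b (t + 1) / S.E - S.energy e₀ b t / S.E))) := by
    rw [Finset.mul_sum, Finset.mul_sum, Finset.mul_sum, Finset.mul_sum, ← Finset.sum_add_distrib,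
      Finset.mul_sum, ← Finset.sum_sub_distrib]
    refine Finset.sum_congr rfl fun t ht => ?_
    obtain ⟨hb1, hb2⟩ := hb.bounds hC (Finset.mem_range.1 ht)
    rw [energy]
    rcases le_total 0 (C * r t) with h | h
    · obtain ⟨h1, h2⟩ := hb1 h
      rw [nextEnergy_of_nonneg S h1, ← sub_div, add_sub_cancel_left,
        abs_of_nonneg (div_nonneg (by positivity) hE.le), abs_of_nonneg (by linarith),
        abs_of_nonneg h, hκ, hc, hk]
      field_simp; ring
    · obtain ⟨h1, h2⟩ := hb2 h
      have h3 : S.M * b t / S.η / S.E ≤ 0 := div_nonpos_of_nonpos_of_nonneg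
        (div_nonpos_of_nonpos_of_nonneg (mul_nonpos_of_nonneg_of_nonpos hM.le h1) hη.le) hE.le
      rw [nextEnergy_of_nonpos S h1, ← sub_div, add_sub_cancel_left,
        abs_of_nonpos h3, abs_of_nonpos (by linarith), abs_of_nonpos h, hκ, hc, hk]
      field_simp; ring
  have haging : S.agingCost Φ e₀ T b = S.E * S.R / 2 * rainflowSum Φ (S.socProfile e₀ b T) := by
    rw [agingCost, lifeLoss, rainflowSum]; ring
  rw [cost, hstep, haging, hsum, htv, htel]
  ring

end Battery

/-! ### Tangents of the stress function -/

theorem tangent_le {Φ : ℝ → ℝ} {d v : ℝ} (hΦ : ConvexOn ℝ (Set.Ici 0) Φ) (hv : 0 ≤ v)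
    (hd : HasDerivWithinAt Φ d (Set.Ici 0) v) {u : ℝ} (hu : 0 ≤ u) :
    Φ v + d * (u - v) ≤ Φ u := by
  rcases lt_trichotomy u v with h | rfl | h
  · have := hΦ.slope_le_of_hasDerivWithinAt hu hv h hd
    rw [slope_def_field, div_le_iff₀ (by linarith)] at this
    linarith
  · simp
  · have := hΦ.le_slope_of_hasDerivWithinAt hv hu h hd
    rw [slope_def_field, le_div_iff₀ (by linarith)] at this
    linarith

theorem monotoneOn_of_concaveOn_of_max {f : ℝ → ℝ} {w : ℝ} (hc : ConcaveOn ℝ (Set.Icc 0 w) f)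
    (hmax : ∀ u, 0 ≤ u → f u ≤ f w) : MonotoneOn f (Set.Icc 0 w) := by
  intro a ha b hb hab
  rcases hab.eq_or_lt with rfl | hab
  · exact le_rfl
  rcases hb.2.eq_or_lt with rfl | hbw
  · exact hmax a ha.1
  have h := hc.slope_anti_adjacent ha ⟨hb.1.trans hb.2, le_rfl⟩ hab hbw
  have h1 : 0 ≤ (f w - f b) / (w - b) := div_nonneg (sub_nonneg.2 (hmax b hb.1)) (by linarith)
  have h2 := h1.trans h
  rw [le_div_iff₀ (by linarith)] at h2
  linarith

theorem theorem1 (S : Battery)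
    (Φ φ : ℝ → ℝ)
    (hΦ : StrictConvexOn ℝ (Set.Ici 0) Φ) (hΦ0 : Φ 0 = 0)
    (hφ : ∀ u : ℝ, 0 ≤ u → HasDerivWithinAt Φ (φ u) (Set.Ici 0) u)
    (δ μlam μr : ℝ) (hδ : δ ∈ Set.Icc (0 : ℝ) 1) (hμlam : 0 ≤ μlam) (hμr : 0 < μr)
    (p : ℝ) (hp : p = S.penaltyPrice δ μlam μr)
    (uhat : ℝ) (huhat : 0 ≤ uhat) (hφu : φ uhat = (S.η ^ 2 + 1) / (S.η * S.R) * p) :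
    -- the policy is admissible and caps the depths of all rainflow cycles at `uhat`
    (∀ (T : ℕ) (e₀ C : ℝ) (r : ℕ → ℝ), e₀ ∈ Set.Icc S.Elo S.Ehi → C ∈ Set.Icc 0 S.B →
      (∀ t < T, r t ∈ Set.Icc (-1 : ℝ) 1) →
      S.Admissible e₀ C r T (S.policy uhat e₀ C r) ∧
      (∀ u ∈ fullCycles (S.socProfile e₀ (S.policy uhat e₀ C r) T), u ≤ uhat) ∧
      (∀ u ∈ halfCycles (S.socProfile e₀ (S.policy uhat e₀ C r) T), u ≤ uhat)) ∧
    -- its regret against every admissible response is bounded independently of the horizon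
    (∃ ε : ℝ, ∀ (T : ℕ) (e₀ C : ℝ) (r : ℕ → ℝ), e₀ ∈ Set.Icc S.Elo S.Ehi → C ∈ Set.Icc 0 S.B →
      (∀ t < T, r t ∈ Set.Icc (-1 : ℝ) 1) →
      ∀ b : ℕ → ℝ, S.Admissible e₀ C r T b →
        S.cost Φ (δ * (μlam / μr)) e₀ C r T (S.policy uhat e₀ C r)
          - S.cost Φ (δ * (μlam / μr)) e₀ C r T b ≤ ε) ∧
    -- the bound in closed form, whenever the optimal half-cycle depths exist
    (∀ vhat what : ℝ, 0 ≤ vhat → 0 ≤ what →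
      φ vhat = 2 * p / (S.η * S.R) → φ what = 2 * p * S.η / S.R →
      ∀ (T : ℕ) (e₀ C : ℝ) (r : ℕ → ℝ), e₀ ∈ Set.Icc S.Elo S.Ehi → C ∈ Set.Icc 0 S.B →
      (∀ t < T, r t ∈ Set.Icc (-1 : ℝ) 1) →
      ∀ b : ℕ → ℝ, S.Admissible e₀ C r T b →
        S.cost Φ (δ * (μlam / μr)) e₀ C r T (S.policy uhat e₀ C r)
          - S.cost Φ (δ * (μlam / μr)) e₀ C r T b
          ≤ 2 * S.dischargeProfit Φ p what + S.chargeProfit Φ p vhat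
            - 2 * S.dischargeProfit Φ p uhat - S.chargeProfit Φ p uhat) := by
  have hE := S.E_pos
  have hR := S.R_pos
  have hη := S.η_pos
  have hM := S.M_pos
  have hER : 0 < S.E * S.R / 2 := by positivity
  have hp0 : 0 ≤ p := by
    have := hδ.1
    rw [hp, Battery.penaltyPrice]; positivity
  have hκ : δ * (μlam / μr) = p * S.M := by
    rw [hp, Battery.penaltyPrice]; field_simp
  obtain ⟨c, hc⟩ : ∃ c, c = (S.η ^ 2 + 1) / (S.η * S.R) * p := ⟨_, rfl⟩
  obtain ⟨k, hk⟩ : ∃ k, k = p * (1 / S.η - S.η) / S.R := ⟨_, rfl⟩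
  have hk0 : 0 ≤ k := by
    have h1 : 1 ≤ 1 / S.η := by rw [le_div_iff₀ hη, one_mul]; exact S.η_le_one
    have h2 := S.η_le_one
    rw [hk]
    exact div_nonneg (mul_nonneg hp0 (by linarith)) hR.le
  have hck : c + k = 2 * p / (S.η * S.R) := by rw [hc, hk]; field_simp; ring
  have hck' : c - k = 2 * p * S.η / S.R := by rw [hc, hk]; field_simp; ring
  have hcv := hΦ.convexOn
  have hconc : ConcaveOn ℝ (Set.Icc 0 uhat) fun v => c * v - Φ v :=
    ((LinearMap.mul ℝ ℝ c).concaveOn (convex_Icc 0 uhat)).sub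
      (hcv.subset Set.Icc_subset_Ici_self (convex_Icc 0 uhat))
  have hmax : ∀ u, 0 ≤ u → c * u - Φ u ≤ c * uhat - Φ uhat := by
    intro u hu
    have := tangent_le hcv huhat (hφ uhat huhat) hu
    rw [hφu, ← hc] at this
    linarith
  have hmono := monotoneOn_of_concaveOn_of_max hconc hmax
  have h0 : c * 0 - Φ 0 = 0 := by rw [hΦ0]; ring
  have hregret : ∀ (T : ℕ) (e₀ C : ℝ) (r : ℕ → ℝ), e₀ ∈ Set.Icc S.Elo S.Ehi → C ∈ Set.Icc 0 S.B →
      (∀ t < T, r t ∈ Set.Icc (-1 : ℝ) 1) → ∀ b : ℕ → ℝ, S.Admissible e₀ C r T b →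
      S.cost Φ (δ * (μlam / μr)) e₀ C r T (S.policy uhat e₀ C r)
          - S.cost Φ (δ * (μlam / μr)) e₀ C r T b =
        S.E * S.R / 2 * (rainflowSum (fun v => c * v - Φ v) (S.socProfile e₀ b T) +
          k * (S.energy e₀ b T / S.E - S.energy e₀ (S.policy uhat e₀ C r) T / S.E) -
          rainflowSum (fun v => c * v - Φ v) (S.socProfile e₀ (S.policy uhat e₀ C r) T)) := by
    intro T e₀ C r he hC hr b hb
    rw [Battery.cost_eq Φ hκ hC.1 hb,
      Battery.cost_eq Φ hκ hC.1 (Battery.admissible_policy huhat he hC hr), ← hc, ← hk]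
    ring
  refine ⟨fun T e₀ C r he hC hr => ?_, ⟨S.E * S.R / 2 * (k * ((S.Ehi - S.Elo) / S.E)), ?_⟩, ?_⟩
  · have hadm := Battery.admissible_policy huhat he hC hr
    have hdom := Battery.dominated_policy huhat he hC.1 hadm
    exact ⟨hadm, fun u hu => hdom.cycle_le (.inl hu), fun u hu => hdom.cycle_le (.inr hu)⟩
  · intro T e₀ C r he hC hr b hb
    have hadm := Battery.admissible_policy huhat he hC hr
    rw [hregret T e₀ C r he hC hr b hb]
    have h1 := (Battery.dominated_policy huhat he hC.1 hb).rainflowSum_le huhat hconc hmono h0 hmax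
    have h2 : S.energy e₀ b T / S.E - S.energy e₀ (S.policy uhat e₀ C r) T / S.E ≤
        (S.Ehi - S.Elo) / S.E := by
      rw [← sub_div]
      exact div_le_div_of_nonneg_right
        (by linarith [(hb.energy_mem T le_rfl).2, (hadm.energy_mem T le_rfl).1]) hE.le
    have h3 := mul_le_mul_of_nonneg_left h2 hk0
    refine mul_le_mul_of_nonneg_left ?_ hER.le
    simp only [Battery.socProfile]
    linarith
  · intro vhat what hv hw hφv hφw T e₀ C r he hC hr b hb
    rw [hregret T e₀ C r he hC hr b hb]
    have h1 := (Battery.dominated_policy huhat he hC.1 hb).rainflowSum_add_le huhat hconc hmono h0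
      hmax hk0 (a := (c + k) * vhat - Φ vhat) (b := (c - k) * what - Φ what)
      (fun u hu => by
        have := tangent_le hcv hv (hφ vhat hv) hu
        rw [hφv, ← hck] at this
        linarith)
      (fun u hu => by
        have := tangent_le hcv hw (hφ what hw) hu
        rw [hφw, ← hck'] at this
        linarith)
    have hJv : ∀ v, S.chargeProfit Φ p v = S.E * S.R / 2 * ((c + k) * v - Φ v) := by
      intro v; rw [Battery.chargeProfit, hck]; field_simp
    have hJw : ∀ v, S.dischargeProfit Φ p v = S.E * S.R / 2 * ((c - k) * v - Φ v) := by
      intro v; rw [Battery.dischargeProfit, hck']; field_simp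
    rw [hJv, hJv, hJw, hJw]
    have h2 := mul_le_mul_of_nonneg_left h1 hER.le
    simp only [Battery.socProfile]
    linarith
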